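/- Dual quaternions $h=p+\varepsilon d$ ($p,d$ quaternions, $\varepsilon^2=0$) are taken with coefficients in $\mathbb{R}(t)$; $h^*=p^*+\varepsilon d^*$, $h_\varepsilon=p-\varepsilon d$, and $[h]$ is the point of the projective space over the $\mathbb{R}(t)$-vector space of dual quaternions. A rational torse is a point $[u]$, $u=\vec u+\varepsilon u_0$, with $\vec u=u_1\mathbf i+u_2\mathbf j+u_3\mathbf k$ and $u_0\in\mathbb{R}(t)$; here $\vec u\neq 0$. A rational motion is a point $[C]$, $C=P+\varepsilon D$, with $P\neq0$ and $PD^*+DP^*=0$; it has trajectory $[u]$ (of the moving plane $[\mathbf k]$) if $[C_\varepsilon\mathbf k C^*]=[u]$, and it fixes $[\mathbf k]$ if $[C_\varepsilon\mathbf k C^*]=[\mathbf k]$ (as an unoriented plane). The degree of a point $[x]$ is the minimal degree of a dual quaternion polynomial in $t$ that represents it. The torse $[u]$ is kinematic if it is represented by a polynomial $w$ whose norm $ww^*$ is the square of a real polynomial. A rational Gauss map of $[u]$ is $n=\vec u/s$ with $s\in\mathbb{R}(t)$, $s^2=N(\vec u)=\vec u\,\vec u^*$ (unique up to sign); $\deg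 n$ is the degree of the rational curve $[1+\varepsilon n]$. Theorem. Let $[u]=[\vec u+\varepsilon u_0]$ be a rational torse with $\vec u\ne0$. It is kinematic if and only if it has a rational Gauss map. If $[u]$ is kinematic with Gauss map $n=\vec u/\sqrt{N(\vec u)}$, then, with $\deg u$ the degree of $[u]$: 1. There exists a rational motion $[C]$ of degree $\deg u-\frac12\deg n$ with trajectory $[u]$. 2. Every rational motion with trajectory $[u]$ has degree at least $\deg u-\frac12\deg n$. 3. The rational motion of minimal degree with trajectory $[u]$ is essentially unique, that is, unique up to right multiplication with a constant displacement $[e]$ (a dual quaternion $e$ with coefficients in $\mathbb{R}$, non-zero primal part, satisfying the Study condition) that fixes $[\mathbf k]$, if and only if $\deg u=\deg n$. 4. If $[C]$ is a rational motion of minimal degree with trajectory $[u]$, then the rational motions with trajectory $[u]$ are exactly the $[CE]$ where $[E]$ is a rational motion that fixes $[\mathbf k]$. The rational motions that fix $[\mathbf k]$ are exactly those represented by $e_0+e_3\mathbf k+\varepsilon(e_5\mathbf i+e_6\mathbf j)$ or by $e_1\mathbf i+e_2\mathbf j+\varepsilon(e_4+e_7\mathbf k)$ with real polynomials $e_i$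 and non-zero primal part. -/

import Mathlib

open scoped Quaternion Polynomial

namespace PlaneMotion

noncomputable section

/-- Dual quaternions `p + ε d` over a commutative ring `R`: the primal part `p` is `fst`,
the dual part `d` is `snd`. -/
abbrev DualQuat (R : Type*) [CommRing R] : Type _ := DualNumber ℍ[R]

/-- The quaternion `a + b i + c j + d k`. -/
def quat {R : Type*} [CommRing R] (a b c d : R) : ℍ[R] := ⟨a, b, c, d⟩

@[simp]
theorem quat_re {R : Type*} [CommRing R] (a b c d : R) : (quat a b c d).re = a := rfl

@[simp]
theorem quat_imI {R : Type*} [CommRing R] (a b c d : R) : (quat a b c d).imI = b := rfl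

@[simp]
theorem quat_imJ {R : Type*} [CommRing R] (a b c d : R) : (quat a b c d).imJ = c := rfl

@[simp]
theorem quat_imK {R : Type*} [CommRing R] (a b c d : R) : (quat a b c d).imK = d := rfl

/-- The dual quaternion `p + ε d`. -/
def mk {R : Type*} [CommRing R] (p d : ℍ[R]) : DualQuat R :=
  TrivSqZeroExt.inl p + TrivSqZeroExt.inr d

@[simp]
theorem fst_mk {R : Type*} [CommRing R] (p d : ℍ[R]) : (mk p d).fst = p :=
  (TrivSqZeroExt.fst_add _ _).trans (add_zero p)

@[simp]
theorem snd_mk {R : Type*} [CommRing R] (p d : ℍ[R]) : (mk p d).snd = d :=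
  (TrivSqZeroExt.snd_add _ _).trans (zero_add d)

/-- Conjugation `p + ε d ↦ p* + ε d*`. -/
def conj {R : Type*} [CommRing R] (h : DualQuat R) : DualQuat R :=
  mk (star h.fst) (star h.snd)

/-- `ε`-conjugation `p + ε d ↦ p - ε d`. -/
def epsConj {R : Type*} [CommRing R] (h : DualQuat R) : DualQuat R :=
  mk h.fst (-h.snd)

/-- The plane `k`, that is, the plane with equation `z = 0`. -/
def planeK (R : Type*) [CommRing R] : DualQuat R :=
  mk (quat 0 0 0 1) 0

/-- Coefficientwise extension of scalars of quaternions. -/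
def mapQuat {R S : Type*} [CommRing R] [CommRing S] (f : R →+* S) (q : ℍ[R]) : ℍ[S] :=
  quat (f q.re) (f q.imI) (f q.imJ) (f q.imK)

/-- Coefficientwise extension of scalars of dual quaternions. -/
def mapDual {R S : Type*} [CommRing R] [CommRing S] (f : R →+* S) (h : DualQuat R) :
    DualQuat S :=
  mk (mapQuat f h.fst) (mapQuat f h.snd)

/-- `[x] = [y]`: equality of the points of projective space over the `K`-vector space of dual
quaternions that have homogeneous coordinate vectors `x` and `y`. -/
def SamePoint {K : Type*} [Field K] (x y : DualQuat K) : Prop :=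
  ∃ c : K, c ≠ 0 ∧ y = c • x

/-- `[C]` is a motion: the primal part does not vanish and the Study condition holds.
Over `ℝ` these are the rigid body displacements, over `ℝ(t)` the rational motions. -/
def IsMotion {K : Type*} [Field K] (C : DualQuat K) : Prop :=
  C.fst ≠ 0 ∧ C.fst * star C.snd + C.snd * star C.fst = 0

/-- The image of the moving plane `k` under the motion `C`. -/
def imageOfK {K : Type*} [Field K] (C : DualQuat K) : DualQuat K :=
  epsConj C * planeK K * conj C

/-- `C` fixes the plane `[k]` (as an unoriented plane). -/
def FixesK {K : Type*} [Field K] (C : DualQuat K) : Prop :=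
  SamePoint (imageOfK C) (planeK K)

/-- The field `ℝ(t)`. -/
abbrev RealRat : Type := RatFunc ℝ

/-- A dual quaternion polynomial, regarded as a dual quaternion over `ℝ(t)`. -/
def ofPoly (w : DualQuat ℝ[X]) : DualQuat RealRat :=
  mapDual (algebraMap ℝ[X] RealRat) w

/-- A constant dual quaternion, regarded as a dual quaternion over `ℝ(t)`. -/
def ofConst (e : DualQuat ℝ) : DualQuat RealRat :=
  mapDual (algebraMap ℝ RealRat) e

/-- Degree of a quaternion polynomial: the maximum of the degrees of its coordinates. -/
def quatDegree (q : ℍ[ℝ[X]]) : ℕ :=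
  max (max q.re.natDegree q.imI.natDegree) (max q.imJ.natDegree q.imK.natDegree)

/-- Degree of a dual quaternion polynomial. -/
def polyDegree (w : DualQuat ℝ[X]) : ℕ :=
  max (quatDegree w.fst) (quatDegree w.snd)

/-- Degree of a rational curve, torse or motion `[x]`: the minimal degree of a polynomial that
represents it. -/
def degree (x : DualQuat RealRat) : ℕ :=
  sInf {d : ℕ | ∃ w : DualQuat ℝ[X], SamePoint x (ofPoly w) ∧ polyDegree w = d}

/-- `[u]` is a rational torse: `u = u₁ i + u₂ j + u₃ k + ε u₀`, not zero. -/
def IsTorse (u : DualQuat RealRat) : Prop :=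
  u ≠ 0 ∧ u.fst.re = 0 ∧ u.snd.im = 0

/-- `[u]` is kinematic: it is represented by a polynomial `w` whose norm `w w*` is the square of
a real polynomial. -/
def IsKinematic (u : DualQuat RealRat) : Prop :=
  ∃ w : DualQuat ℝ[X], SamePoint u (ofPoly w) ∧
    ∃ s : ℝ[X], w * conj w = mk ((s ^ 2 : ℝ[X]) : ℍ[ℝ[X]]) 0

/-- `n` is a rational Gauss map of the torse `[u]`: the quotient of the vector part of `u` by a
square root in `ℝ(t)` of its norm (unique up to sign). -/
def IsGaussMap (u : DualQuat RealRat) (n : ℍ[RealRat]) : Prop :=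
  ∃ s : RealRat, s ≠ 0 ∧ s ^ 2 = Quaternion.normSq u.fst ∧ n = s⁻¹ • u.fst

/-- The rational curve `[1 + ε n]` traced by the point with coordinate vector `n`. -/
def curveOf (n : ℍ[RealRat]) : DualQuat RealRat :=
  mk 1 n

/-- `[C]` is a rational motion with trajectory `[u]` (of the moving plane `[k]`). -/
def HasTrajectory (C u : DualQuat RealRat) : Prop :=
  IsMotion C ∧ SamePoint (imageOfK C) u

/-- `[C]` has minimal degree among all rational motions with trajectory `[u]`. -/
def IsMinimalMotion (C u : DualQuat RealRat) : Prop :=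
  HasTrajectory C u ∧ ∀ C' : DualQuat RealRat, HasTrajectory C' u → degree C ≤ degree C'

/-- `[C']` arises from `[C]` by right multiplication with a constant displacement that fixes the
plane `[k]`. -/
def EssentiallyEqual (C C' : DualQuat RealRat) : Prop :=
  ∃ e : DualQuat ℝ, IsMotion e ∧ FixesK e ∧ SamePoint (C * ofConst e) C'

end

end PlaneMotion

open PlaneMotion

/-!
The quaternions `a + b k` form a copy of the complex numbers, so a quaternion polynomial is a pair
of complex polynomials `(x, y)`, and `p ↦ p k p*` (`rotK`) is the Hopf map. Right multiplication by
`a + b k` multiplies `x` and `y` by a complex polynomial, and `p k p*` by the real polynomial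
`a² + b²`.

*Normal form.* If `s² = N(v)` for the vector part `v` of `u`, then `v + s k` is, for one of the two
signs of `s`, a half-turn that maps `k` to a multiple of `v`. Clearing denominators and dividing by
the complex gcd of `x` and `y` gives `p` with coprime `x`, `y` and
`[u] = [g p k p* + ε u₀]`, where `g` and `u₀` are coprime (`exists_normalForm`). Coprimality of `x`
and `y` is used in the form of a Bézout identity: some `m` satisfies `m p = 1 + r i + s j`. It
implies that `p k p*` is primitive, so that `deg u = max (deg g + 2 deg p, deg u₀)` and
`deg n = 2 deg p`.

*Motions with trajectory `[u]`.* The primal part of such a motion polynomial `w` is `p` times an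
element `a + b k` (up to a half-turn), and the Bézout identity makes `a` and `b` polynomials. The
Study condition and the equation for `u₀` determine the complex part of `d* p`, where `d` is the
dual part; coprimality of `g` and `u₀` then forces `g ∣ a` and `g ∣ b`. The outcome
(`exists_eq_motionPoly`) is
`w = (g p + ε d) (a + b k) + ε p (l₁ i + l₂ j)`
with one fixed `d`, for which the complex part of `d* p` is `-u₀ k / 2`. Comparing degrees in the
primal part, and in the complex part of (dual part)* times `p`, bounds the degree below by
`max (deg g + deg p, deg u₀ - deg p) = deg u - deg n / 2`. A Bézout equation with degree bound
(`exists_bezout_degree_le`) yields a `d` that attains the bound.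

*Uniqueness.* If `deg u = deg n`, then `g` is constant and minimality of the degree makes
`a, b, l₁, l₂` constant, so that all minimal motions differ by constant displacements. Otherwise
`l₁ = 0`, `1`, `t` all give motions of minimal degree, and these cannot all be essentially equal.

That two motions with the same trajectory differ by a motion fixing `k` is group theory: the
difference is `C* C'`.
-/

namespace PlaneMotion

/-! ### Quaternions and dual quaternions over a commutative ring -/

section Algebra

variable {R : Type*} [CommRing R]

theorem conj_mul (x y : DualQuat R) : conj (x * y) = conj y * conj x := by
  apply TrivSqZeroExt.ext
  · simp [conj]
  · simp [conj, add_comm]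

theorem conj_conj (x : DualQuat R) : conj (conj x) = x := by
  apply TrivSqZeroExt.ext <;> simp [conj]

theorem epsConj_mul (x y : DualQuat R) : epsConj (x * y) = epsConj x * epsConj y := by
  apply TrivSqZeroExt.ext
  · simp [epsConj]
  · simp [epsConj]
    abel

theorem conj_smul (c : R) (x : DualQuat R) : conj (c • x) = c • conj x := by
  apply TrivSqZeroExt.ext <;> simp [conj]

theorem epsConj_smul (c : R) (x : DualQuat R) : epsConj (c • x) = c • epsConj x := by
  apply TrivSqZeroExt.ext <;> simp [epsConj]

theorem smul_one_mul (c : R) (x : DualQuat R) : (c • (1 : DualQuat R)) * x = c • x := by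
  apply TrivSqZeroExt.ext <;> simp

theorem mul_smul_one (c : R) (x : DualQuat R) : x * (c • (1 : DualQuat R)) = c • x := by
  apply TrivSqZeroExt.ext <;> simp

theorem dualQuat_mul_smul (c : R) (x y : DualQuat R) : x * (c • y) = c • (x * y) := by
  apply TrivSqZeroExt.ext <;> simp

theorem dualQuat_smul_mul (c : R) (x y : DualQuat R) : (c • x) * y = c • (x * y) := by
  apply TrivSqZeroExt.ext <;> simp

/-- The vector `p k p*`, which is, up to the factor `N(p)`, the image of the unit vector `k`
under the rotation given by `p`. -/
def rotK (p : ℍ[R]) : ℍ[R] := p * quat 0 0 0 1 * star p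

theorem rotK_mul (p q : ℍ[R]) : rotK (p * q) = p * rotK q * star p := by
  simp [rotK, mul_assoc]

theorem rotK_smul (c : R) (p : ℍ[R]) : rotK (c • p) = c ^ 2 • rotK p := by
  simp [rotK, smul_smul, pow_two]

theorem normSq_eq (q : ℍ[R]) :
    Quaternion.normSq q = q.re ^ 2 + q.imI ^ 2 + q.imJ ^ 2 + q.imK ^ 2 :=
  Quaternion.normSq_def' q

theorem normSq_rotK (p : ℍ[R]) : Quaternion.normSq (rotK p) = Quaternion.normSq p ^ 2 := by
  rw [rotK, map_mul, map_mul, Quaternion.normSq_star]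
  simp [normSq_eq]
  ring

theorem normSq_smul_eq (c : R) (q : ℍ[R]) :
    Quaternion.normSq (c • q) = c ^ 2 * Quaternion.normSq q := by
  simp [normSq_eq]
  ring

theorem star_mul_self_eq (q : ℍ[R]) : star q * q = Quaternion.normSq q • (1 : ℍ[R]) := by
  ext <;> simp [normSq_eq] <;> ring

theorem mul_star_self_eq (q : ℍ[R]) : q * star q = Quaternion.normSq q • (1 : ℍ[R]) := by
  ext <;> simp [normSq_eq] <;> ring

theorem study_expr (p d : ℍ[R]) :
    p * star d + d * star p = quat (2 * (p * star d).re) 0 0 0 := by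
  ext <;> simp <;> ring

/-- If the vector `x k x*` is parallel to `k`, then `x` is the rotation quaternion of a rotation
around `k` or of a half-turn around a line orthogonal to `k`. -/
theorem complex_or_of_rotK [IsDomain R] (hR : ∀ a b : R, a ^ 2 + b ^ 2 = 0 → a = 0 ∧ b = 0)
    (x : ℍ[R]) (hI : (rotK x).imI = 0) (hJ : (rotK x).imJ = 0) :
    (x.imI = 0 ∧ x.imJ = 0) ∨ (x.re = 0 ∧ x.imK = 0) := by
  simp [rotK] at hI hJ
  -- the squared length of the part of `x k x*` orthogonal to `k`
  have h : 4 * ((x.re ^ 2 + x.imK ^ 2) * (x.imI ^ 2 + x.imJ ^ 2)) = 0 := by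
    linear_combination (x.imI * x.imK * 2 + x.re * x.imJ * 2) * hI +
      (x.imJ * x.imK * 2 - x.re * x.imI * 2) * hJ
  have h2 : (2 : R) ≠ 0 := by
    intro h2
    have := (hR 1 1 (by linear_combination h2)).1
    exact one_ne_zero this
  have h4 : (4 : R) ≠ 0 := by
    have : (4 : R) = 2 * 2 := by norm_num
    rw [this]
    exact mul_ne_zero h2 h2
  rcases mul_eq_zero.1 h with h | h
  · exact absurd h h4
  · rcases mul_eq_zero.1 h with h | h
    · exact Or.inr (hR _ _ h)
    · exact Or.inl (hR _ _ h)

theorem quat_smul_cancel [IsDomain R] {c : R} (hc : c ≠ 0) {p q : ℍ[R]} (h : c • p = c • q) :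
    p = q := by
  simp only [Quaternion.ext_iff, Quaternion.re_smul, Quaternion.imI_smul, Quaternion.imJ_smul,
    Quaternion.imK_smul, smul_eq_mul] at h
  ext1 <;> apply mul_left_cancel₀ hc
  exacts [h.1, h.2.1, h.2.2.1, h.2.2.2]

theorem quat_smul_mul (c : R) (p q : ℍ[R]) : (c • p) * q = c • (p * q) := smul_mul_assoc c p q

theorem quat_mul_smul (c : R) (p q : ℍ[R]) : p * (c • q) = c • (p * q) := mul_smul_comm c p q

/-- If `p* w` lies in `R[k]`, then `w` is a right multiple of `p` by an element of `R[k]`. -/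
theorem eq_mul_of_star_mul_complex [IsDomain R] {p m w : ℍ[R]}
    (hp : Quaternion.normSq p ≠ 0) (hr : (m * p).re = 1) (hk : (m * p).imK = 0)
    (hI : (star p * w).imI = 0) (hJ : (star p * w).imJ = 0) :
    w = p * quat (m * w).re 0 0 (m * w).imK := by
  have h1 : Quaternion.normSq p • (m * w) = (m * p) * (star p * w) := by
    rw [mul_assoc, ← mul_assoc p, mul_star_self_eq]
    simp
  have h2 : star p * w = Quaternion.normSq p • quat (m * w).re 0 0 (m * w).imK := by
    rw [Quaternion.ext_iff] at h1
    simp only [Quaternion.re_smul, Quaternion.imK_smul, Quaternion.re_mul (m * p),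
      Quaternion.imK_mul (m * p), hr, hk, hI, hJ] at h1
    ext1
    · simpa using h1.1.symm
    · simp [hI]
    · simp [hJ]
    · simpa using h1.2.2.2.symm
  have h3 : Quaternion.normSq p • w =
      Quaternion.normSq p • (p * quat (m * w).re 0 0 (m * w).imK) := by
    rw [← mul_smul_comm, ← h2, ← mul_assoc, mul_star_self_eq]
    simp
  exact quat_smul_cancel hp h3

/-- If `p* w` is a linear combination of `i` and `j`, then so is `p⁻¹ w`, with
coefficients in `R`. -/
theorem eq_mul_of_star_mul_noncomplex [IsDomain R] {p m w : ℍ[R]}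
    (hp : Quaternion.normSq p ≠ 0) (hr : (m * p).re = 1)
    (hk : (m * p).imK = 0) (h0 : (star p * w).re = 0) (h3 : (star p * w).imK = 0) :
    w = p * quat 0 (m * w).imI (m * w).imJ 0 := by
  have h1 : Quaternion.normSq p • (m * w) = (m * p) * (star p * w) := by
    rw [mul_assoc, ← mul_assoc p, mul_star_self_eq]
    simp
  have h2 : star p * w = Quaternion.normSq p • quat 0 (m * w).imI (m * w).imJ 0 := by
    rw [Quaternion.ext_iff] at h1
    simp only [Quaternion.imI_smul, Quaternion.imJ_smul, Quaternion.imI_mul (m * p),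
      Quaternion.imJ_mul (m * p), hr, hk, h0, h3] at h1
    ext1
    · simp [h0]
    · simpa using h1.2.1.symm
    · simpa using h1.2.2.1.symm
    · simp [h3]
  have h3 : Quaternion.normSq p • w =
      Quaternion.normSq p • (p * quat 0 (m * w).imI (m * w).imJ 0) := by
    rw [← mul_smul_comm, ← h2, ← mul_assoc, mul_star_self_eq]
    simp
  exact quat_smul_cancel hp h3

end Algebra

/-! ### Motions over a field -/

section Field

variable {K : Type*} [Field K]

theorem SamePoint.refl (x : DualQuat K) : SamePoint x x := ⟨1, one_ne_zero, (one_smul _ _).symm⟩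

theorem SamePoint.symm {x y : DualQuat K} (h : SamePoint x y) : SamePoint y x := by
  obtain ⟨c, hc, rfl⟩ := h
  exact ⟨c⁻¹, inv_ne_zero hc, by rw [smul_smul, inv_mul_cancel₀ hc, one_smul]⟩

theorem SamePoint.trans {x y z : DualQuat K} (h : SamePoint x y) (h' : SamePoint y z) :
    SamePoint x z := by
  obtain ⟨c, hc, rfl⟩ := h
  obtain ⟨d, hd, rfl⟩ := h'
  exact ⟨d * c, mul_ne_zero hd hc, by rw [smul_smul]⟩

theorem samePoint_smul {c : K} (hc : c ≠ 0) (x : DualQuat K) : SamePoint x (c • x) := ⟨c, hc, rfl⟩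

theorem SamePoint.mul {x x' y y' : DualQuat K} (hx : SamePoint x x') (hy : SamePoint y y') :
    SamePoint (x * y) (x' * y') := by
  obtain ⟨c, hc, rfl⟩ := hx
  obtain ⟨d, hd, rfl⟩ := hy
  exact ⟨c * d, mul_ne_zero hc hd, by
    rw [dualQuat_mul_smul, dualQuat_smul_mul, smul_smul, mul_comm]⟩

theorem SamePoint.imageOfK {x y : DualQuat K} (h : SamePoint x y) :
    SamePoint (imageOfK x) (imageOfK y) := by
  obtain ⟨c, hc, rfl⟩ := h
  refine ⟨c ^ 2, pow_ne_zero 2 hc, ?_⟩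
  simp only [PlaneMotion.imageOfK, conj_smul, epsConj_smul, dualQuat_mul_smul, dualQuat_smul_mul,
    smul_smul, pow_two]

theorem imageOfK_mul (x y : DualQuat K) :
    imageOfK (x * y) = epsConj x * imageOfK y * conj x := by
  simp only [imageOfK, conj_mul, epsConj_mul, mul_assoc]

theorem imageOfK_eq (C : DualQuat K) :
    imageOfK C = mk (rotK C.fst) (quat (2 * (C.fst * quat 0 0 0 1 * star C.snd).re) 0 0 0) := by
  apply TrivSqZeroExt.ext
  · simp [imageOfK, rotK, epsConj, conj, planeK]
  · ext <;> simp [imageOfK, epsConj, conj, planeK] <;> ring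

theorem isMotion_iff_mul_conj (C : DualQuat K) :
    IsMotion C ↔ C.fst ≠ 0 ∧ C * conj C = Quaternion.normSq C.fst • (1 : DualQuat K) := by
  refine and_congr_right fun _ => ?_
  rw [TrivSqZeroExt.ext_iff]
  simp [conj, mul_star_self_eq]

theorem isMotion_iff_conj_mul (C : DualQuat K) :
    IsMotion C ↔ C.fst ≠ 0 ∧ conj C * C = Quaternion.normSq C.fst • (1 : DualQuat K) := by
  refine and_congr_right fun _ => ?_
  rw [TrivSqZeroExt.ext_iff, study_expr]
  have : star C.fst * C.snd + star C.snd * C.fst = quat (2 * (C.fst * star C.snd).re) 0 0 0 := by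
    ext <;> simp <;> ring
  simp [conj, star_mul_self_eq, this]

theorem SamePoint.isMotion {x y : DualQuat K} (h : SamePoint x y) (hx : IsMotion x) :
    IsMotion y := by
  obtain ⟨c, hc, rfl⟩ := h
  obtain ⟨h1, h2⟩ := hx
  refine ⟨by simpa [hc] using h1, ?_⟩
  simp [← smul_add, h2]

theorem IsMotion.mul [NoZeroDivisors ℍ[K]] {x y : DualQuat K} (hx : IsMotion x)
    (hy : IsMotion y) : IsMotion (x * y) := by
  rw [isMotion_iff_mul_conj] at *
  refine ⟨by simpa using ⟨hx.1, hy.1⟩, ?_⟩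
  rw [conj_mul, mul_assoc, ← mul_assoc y, hy.2, smul_one_mul, dualQuat_mul_smul, hx.2, smul_smul]
  simp [mul_comm]

theorem IsMotion.conj {x : DualQuat K} (hx : IsMotion x) : IsMotion (conj x) := by
  rw [isMotion_iff_conj_mul] at hx
  rw [isMotion_iff_mul_conj, conj_conj, hx.2]
  simpa [PlaneMotion.conj] using hx.1

theorem IsMotion.normSq_ne_zero [NoZeroDivisors ℍ[K]] {C : DualQuat K} (h : IsMotion C) :
    Quaternion.normSq C.fst ≠ 0 := by
  intro h0
  have h1 := mul_star_self_eq C.fst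
  rw [h0, zero_smul, mul_eq_zero, star_eq_zero, or_self] at h1
  exact h.1 h1

/-- If `C` and `C'` map `k` to the same plane, then `C' = C E` up to a factor, where `E = C* C'`
fixes `k`. -/
theorem exists_mul_samePoint [NoZeroDivisors ℍ[K]] {C C' : DualQuat K} (hC : IsMotion C)
    (hC' : IsMotion C') (h : SamePoint (imageOfK C') (imageOfK C)) :
    ∃ E : DualQuat K, IsMotion E ∧ FixesK E ∧ SamePoint (C * E) C' := by
  have hN := hC.normSq_ne_zero
  have h1 := ((isMotion_iff_mul_conj C).1 hC).2
  have h2 := ((isMotion_iff_conj_mul C).1 hC).2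
  refine ⟨PlaneMotion.conj C * C', hC.conj.mul hC', ?_, ?_⟩
  · have h4 := ((SamePoint.refl (epsConj (PlaneMotion.conj C))).mul h).mul (SamePoint.refl C)
    have h5 : epsConj (PlaneMotion.conj C) * PlaneMotion.imageOfK C * C =
        (Quaternion.normSq C.fst * Quaternion.normSq C.fst) • planeK K := by
      calc epsConj (PlaneMotion.conj C) * PlaneMotion.imageOfK C * C
          = epsConj (PlaneMotion.conj C * C) * planeK K * (PlaneMotion.conj C * C) := by
            simp only [PlaneMotion.imageOfK, epsConj_mul, mul_assoc]
        _ = _ := by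
            rw [h2, epsConj_smul, mul_smul_one, dualQuat_smul_mul, smul_smul]
            congr 1
            apply TrivSqZeroExt.ext <;> simp [epsConj]
    rw [h5] at h4
    rw [FixesK, imageOfK_mul, conj_conj]
    exact h4.trans (samePoint_smul (mul_ne_zero hN hN) _).symm
  · rw [← mul_assoc, h1, smul_one_mul]
    exact (samePoint_smul hN _).symm

theorem fixesK_rotation {a b : K} (h : a ^ 2 + b ^ 2 ≠ 0) (c d : K) :
    IsMotion (mk (quat a 0 0 b) (quat 0 c d 0)) ∧ FixesK (mk (quat a 0 0 b) (quat 0 c d 0)) := by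
  refine ⟨⟨?_, ?_⟩, SamePoint.symm ⟨a ^ 2 + b ^ 2, h, ?_⟩⟩
  · intro h0
    simp [Quaternion.ext_iff] at h0
    simp [h0] at h
  · ext <;> simp <;> ring
  · rw [imageOfK_eq]
    apply TrivSqZeroExt.ext <;> ext <;> simp [rotK, planeK] <;> ring

theorem fixesK_halfTurn {a b : K} (h : a ^ 2 + b ^ 2 ≠ 0) (c d : K) :
    IsMotion (mk (quat 0 a b 0) (quat c 0 0 d)) ∧ FixesK (mk (quat 0 a b 0) (quat c 0 0 d)) := by
  refine ⟨⟨?_, ?_⟩, SamePoint.symm ⟨-(a ^ 2 + b ^ 2), neg_ne_zero.2 h, ?_⟩⟩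
  · intro h0
    simp [Quaternion.ext_iff] at h0
    simp [h0] at h
  · ext <;> simp <;> ring
  · rw [imageOfK_eq]
    apply TrivSqZeroExt.ext <;> ext <;> simp [rotK, planeK] <;> ring

end Field

/-! ### The field of rational functions and motions that fix `k` -/

section RealRat

theorem poly_eq_zero_of_sq_add_sq {a b : ℝ[X]} (h : a ^ 2 + b ^ 2 = 0) : a = 0 ∧ b = 0 := by
  have key : ∀ x : ℝ, a.eval x = 0 ∧ b.eval x = 0 := by
    intro x
    have := congrArg (Polynomial.eval x) h
    simp only [Polynomial.eval_add, Polynomial.eval_pow, Polynomial.eval_zero] at this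
    constructor <;> nlinarith [sq_nonneg (a.eval x), sq_nonneg (b.eval x)]
  exact ⟨Polynomial.funext fun x => by simpa using (key x).1,
    Polynomial.funext fun x => by simpa using (key x).2⟩

theorem poly_eq_zero_of_sum_four_sq {a b c d : ℝ[X]} (h : a ^ 2 + b ^ 2 + c ^ 2 + d ^ 2 = 0) :
    a = 0 ∧ b = 0 ∧ c = 0 ∧ d = 0 := by
  have key : ∀ x : ℝ, a.eval x = 0 ∧ b.eval x = 0 ∧ c.eval x = 0 ∧ d.eval x = 0 := by
    intro x
    have := congrArg (Polynomial.eval x) h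
    simp only [Polynomial.eval_add, Polynomial.eval_pow, Polynomial.eval_zero] at this
    refine ⟨?_, ?_, ?_, ?_⟩ <;> nlinarith [sq_nonneg (a.eval x), sq_nonneg (b.eval x),
      sq_nonneg (c.eval x), sq_nonneg (d.eval x)]
  exact ⟨Polynomial.funext fun x => by simpa using (key x).1,
    Polynomial.funext fun x => by simpa using (key x).2.1,
    Polynomial.funext fun x => by simpa using (key x).2.2.1,
    Polynomial.funext fun x => by simpa using (key x).2.2.2⟩

/-- The inclusion of `ℝ[t]` into `ℝ(t)`. -/
noncomputable def toRat : ℝ[X] →+* RealRat := algebraMap ℝ[X] RealRat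

theorem toRat_injective : Function.Injective toRat := IsFractionRing.injective ℝ[X] RealRat

@[simp] theorem toRat_eq_zero {a : ℝ[X]} : toRat a = 0 ↔ a = 0 := by
  rw [← map_zero toRat, toRat_injective.eq_iff]

theorem toRat_ne_zero {a : ℝ[X]} (h : a ≠ 0) : toRat a ≠ 0 := by
  simpa using h

/-- Finitely many rational functions have a common denominator `b`. -/
theorem exists_common_denom {ι : Type*} [Finite ι] (f : ι → RealRat) :
    ∃ b : ℝ[X], b ≠ 0 ∧ ∃ g : ι → ℝ[X], ∀ i, toRat (g i) = toRat b * f i := by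
  obtain ⟨b, hb⟩ := IsLocalization.exist_integer_multiples_of_finite (nonZeroDivisors ℝ[X]) f
  choose g hg using hb
  refine ⟨b, nonZeroDivisors.ne_zero b.2, g, fun i => ?_⟩
  exact (hg i).trans (Algebra.smul_def (A := RealRat) b.1 (f i))

theorem realRat_eq_zero_of_sum_four_sq {a b c d : RealRat} (h : a ^ 2 + b ^ 2 + c ^ 2 + d ^ 2 = 0) :
    a = 0 ∧ b = 0 ∧ c = 0 ∧ d = 0 := by
  obtain ⟨m, hm, g, hg⟩ := exists_common_denom ![a, b, c, d]
  have h0 := hg 0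
  have h1 := hg 1
  have h2 := hg 2
  have h3 := hg 3
  simp at h0 h1 h2 h3
  have hs : g 0 ^ 2 + g 1 ^ 2 + g 2 ^ 2 + g 3 ^ 2 = 0 := by
    apply toRat_injective
    simp only [map_add, map_pow, h0, h1, h2, h3, map_zero]
    linear_combination (toRat m) ^ 2 * h
  obtain ⟨e0, e1, e2, e3⟩ := poly_eq_zero_of_sum_four_sq hs
  have := toRat_ne_zero hm
  simp_all

theorem realRat_eq_zero_of_sq_add_sq (a b : RealRat) (h : a ^ 2 + b ^ 2 = 0) : a = 0 ∧ b = 0 := by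
  have := realRat_eq_zero_of_sum_four_sq (a := a) (b := b) (c := 0) (d := 0) (by simpa using h)
  exact ⟨this.1, this.2.1⟩

theorem normSq_poly_eq_zero {q : ℍ[ℝ[X]]} : Quaternion.normSq q = 0 ↔ q = 0 := by
  constructor
  · intro h
    rw [normSq_eq] at h
    obtain ⟨h0, h1, h2, h3⟩ := poly_eq_zero_of_sum_four_sq h
    ext1 <;> assumption
  · rintro rfl
    simp

theorem normSq_rat_eq_zero {q : ℍ[RealRat]} : Quaternion.normSq q = 0 ↔ q = 0 := by
  constructor
  · intro h
    rw [normSq_eq] at h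
    obtain ⟨h0, h1, h2, h3⟩ := realRat_eq_zero_of_sum_four_sq h
    ext1 <;> assumption
  · rintro rfl
    simp

instance : NoZeroDivisors ℍ[ℝ[X]] where
  eq_zero_or_eq_zero_of_mul_eq_zero {a b} h := by
    rwa [← normSq_poly_eq_zero, map_mul, mul_eq_zero, normSq_poly_eq_zero,
      normSq_poly_eq_zero] at h

instance : NoZeroDivisors ℍ[RealRat] where
  eq_zero_or_eq_zero_of_mul_eq_zero {a b} h := by
    rwa [← normSq_rat_eq_zero, map_mul, mul_eq_zero, normSq_rat_eq_zero,
      normSq_rat_eq_zero] at h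

/-- Two motions with the same trajectory differ by a motion that fixes `k`. -/
theorem hasTrajectory_iff_exists_mul {C u : DualQuat RealRat} (hC : HasTrajectory C u)
    (C' : DualQuat RealRat) :
    HasTrajectory C' u ↔ ∃ E : DualQuat RealRat, IsMotion E ∧ FixesK E ∧ SamePoint (C * E) C' := by
  constructor
  · rintro ⟨hm, ht⟩
    exact exists_mul_samePoint hC.1 hm (ht.trans hC.2.symm)
  · rintro ⟨E, hE, hf, hs⟩
    refine ⟨hs.isMotion (hC.1.mul hE), ?_⟩
    refine hs.symm.imageOfK.trans ?_
    rw [imageOfK_mul]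
    refine SamePoint.trans ?_ hC.2
    exact ((SamePoint.refl _).mul hf).mul (SamePoint.refl _)

theorem fixesK_coords {E : DualQuat RealRat} (hE : IsMotion E) (hf : FixesK E) :
    (E.fst.imI = 0 ∧ E.fst.imJ = 0 ∧ E.snd.re = 0 ∧ E.snd.imK = 0) ∨
      (E.fst.re = 0 ∧ E.fst.imK = 0 ∧ E.snd.imI = 0 ∧ E.snd.imJ = 0) := by
  obtain ⟨c, hc, h⟩ := hf.symm
  rw [imageOfK_eq] at h
  have h1 := congrArg TrivSqZeroExt.fst h
  have h2 := congrArg (fun x => x.snd.re) h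
  simp [planeK] at h1 h2
  have hs := hE.2
  rw [study_expr] at hs
  have hs := congrArg (fun x => x.re) hs
  simp at hs
  have hz := hE.normSq_ne_zero
  rw [normSq_eq] at hz
  rcases complex_or_of_rotK realRat_eq_zero_of_sq_add_sq E.fst (by rw [h1]; simp)
    (by rw [h1]; simp) with
    ⟨ha, hb⟩ | ⟨ha, hb⟩
  · simp only [ha, hb] at hz hs h2 ⊢
    left
    refine ⟨trivial, trivial, ?_, ?_⟩ <;> apply mul_left_cancel₀ hz
    · linear_combination E.fst.re * hs - E.fst.imK * h2
    · linear_combination E.fst.imK * hs + E.fst.re * h2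
  · simp only [ha, hb] at hz hs h2 ⊢
    right
    refine ⟨trivial, trivial, ?_, ?_⟩ <;> apply mul_left_cancel₀ hz
    · linear_combination E.fst.imI * hs + E.fst.imJ * h2
    · linear_combination E.fst.imJ * hs - E.fst.imI * h2

@[simp] theorem ofPoly_fst (w : DualQuat ℝ[X]) :
    (ofPoly w).fst = mapQuat toRat w.fst := by simp [ofPoly, mapDual, toRat]

@[simp] theorem ofPoly_snd (w : DualQuat ℝ[X]) :
    (ofPoly w).snd = mapQuat toRat w.snd := by simp [ofPoly, mapDual, toRat]

theorem exists_ofPoly (x : DualQuat RealRat) :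
    ∃ b : ℝ[X], b ≠ 0 ∧ ∃ w, ofPoly w = toRat b • x := by
  obtain ⟨b, hb, g, hg⟩ := exists_common_denom
    ![x.fst.re, x.fst.imI, x.fst.imJ, x.fst.imK, x.snd.re, x.snd.imI, x.snd.imJ, x.snd.imK]
  refine ⟨b, hb, mk (quat (g 0) (g 1) (g 2) (g 3)) (quat (g 4) (g 5) (g 6) (g 7)), ?_⟩
  apply TrivSqZeroExt.ext <;> ext <;> simp [mapQuat, hg]

theorem fixesK_shape (E : DualQuat RealRat) : (IsMotion E ∧ FixesK E) ↔
      ∃ a b c d : ℝ[X], (a ≠ 0 ∨ b ≠ 0) ∧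
        (SamePoint E (ofPoly (mk (quat a 0 0 b) (quat 0 c d 0))) ∨
         SamePoint E (ofPoly (mk (quat 0 a b 0) (quat c 0 0 d)))) := by
  constructor
  · rintro ⟨hE, hf⟩
    obtain ⟨m, hm, w, hw⟩ := exists_ofPoly E
    have hm' := toRat_ne_zero hm
    have hs : SamePoint E (ofPoly w) := hw ▸ samePoint_smul hm' E
    have h1 := congrArg TrivSqZeroExt.fst hw
    have h2 := congrArg TrivSqZeroExt.snd hw
    have hne : w.fst ≠ 0 := by
      intro h0
      apply hE.1
      simp [h0, mapQuat, hm', Quaternion.ext_iff] at h1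
      ext1 <;> simp [h1]
    simp [Quaternion.ext_iff, mapQuat] at h1 h2
    rcases fixesK_coords hE hf with ⟨e1, e2, e3, e4⟩ | ⟨e1, e2, e3, e4⟩
    · simp [e1, e2, e3, e4] at h1 h2
      have hw' : w = mk (quat w.fst.re 0 0 w.fst.imK) (quat 0 w.snd.imI w.snd.imJ 0) := by
        apply TrivSqZeroExt.ext <;> ext1 <;> simp [h1, h2]
      refine ⟨_, _, _, _, ?_, Or.inl (hw' ▸ hs)⟩
      by_contra! hc
      exact hne (by ext1 <;> simp [h1, hc])
    · simp [e1, e2, e3, e4] at h1 h2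
      have hw' : w = mk (quat 0 w.fst.imI w.fst.imJ 0) (quat w.snd.re 0 0 w.snd.imK) := by
        apply TrivSqZeroExt.ext <;> ext1 <;> simp [h1, h2]
      refine ⟨_, _, _, _, ?_, Or.inr (hw' ▸ hs)⟩
      by_contra! hc
      exact hne (by ext1 <;> simp [h1, hc])
  · rintro ⟨a, b, c, d, hab, h | h⟩
    all_goals
      have hN : toRat (a ^ 2 + b ^ 2) ≠ 0 := by
        apply toRat_ne_zero
        intro h0
        obtain ⟨ha, hb⟩ := poly_eq_zero_of_sq_add_sq h0
        simp [ha, hb] at hab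
    · obtain ⟨h1, h2⟩ := fixesK_rotation (by simpa using hN) (toRat c) (toRat d)
      have e : ofPoly (mk (quat a 0 0 b) (quat 0 c d 0)) =
          mk (quat (toRat a) 0 0 (toRat b)) (quat 0 (toRat c) (toRat d) 0) := by
        apply TrivSqZeroExt.ext <;> ext1 <;> simp [mapQuat]
      rw [e] at h
      exact ⟨h.symm.isMotion h1, h.imageOfK.trans h2⟩
    · obtain ⟨h1, h2⟩ := fixesK_halfTurn (by simpa using hN) (toRat c) (toRat d)
      have e : ofPoly (mk (quat 0 a b 0) (quat c 0 0 d)) =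
          mk (quat 0 (toRat a) (toRat b) 0) (quat (toRat c) 0 0 (toRat d)) := by
        apply TrivSqZeroExt.ext <;> ext1 <;> simp [mapQuat]
      rw [e] at h
      exact ⟨h.symm.isMotion h1, h.imageOfK.trans h2⟩

end RealRat

/-! ### Degrees of quaternion polynomials -/

section Degree

theorem quatDegree_le_iff {q : ℍ[ℝ[X]]} {n : ℕ} : quatDegree q ≤ n ↔
    q.re.natDegree ≤ n ∧ q.imI.natDegree ≤ n ∧ q.imJ.natDegree ≤ n ∧ q.imK.natDegree ≤ n := by
  simp [quatDegree]

/-- Sums of squares of real polynomials have no cancellation in the leading coefficient. -/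
theorem natDegree_normSq (q : ℍ[ℝ[X]]) :
    (Quaternion.normSq q).natDegree = 2 * quatDegree q := by
  obtain ⟨h0, h1, h2, h3⟩ := quatDegree_le_iff.1 (le_refl (quatDegree q))
  by_cases hm : quatDegree q = 0
  · rw [hm] at h0 h1 h2 h3 ⊢
    rw [Nat.le_zero, Polynomial.natDegree_eq_zero] at h0 h1 h2 h3
    obtain ⟨a, ha⟩ := h0
    obtain ⟨b, hb⟩ := h1
    obtain ⟨c, hc⟩ := h2
    obtain ⟨d, hd⟩ := h3
    rw [normSq_eq, ← ha, ← hb, ← hc, ← hd]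
    simp only [← map_pow, ← map_add, Polynomial.natDegree_C, mul_zero]
  · apply Polynomial.natDegree_eq_of_le_of_coeff_ne_zero
    · rw [normSq_eq]
      refine Polynomial.natDegree_add_le_of_degree_le (Polynomial.natDegree_add_le_of_degree_le
        (Polynomial.natDegree_add_le_of_degree_le ?_ ?_) ?_) ?_
      all_goals exact Polynomial.natDegree_pow_le_of_le 2 ‹_›
    · rw [normSq_eq]
      simp only [Polynomial.coeff_add, Polynomial.coeff_pow_of_natDegree_le h0,
        Polynomial.coeff_pow_of_natDegree_le h1, Polynomial.coeff_pow_of_natDegree_le h2,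
        Polynomial.coeff_pow_of_natDegree_le h3]
      have key : ∀ f : ℝ[X], f.natDegree = quatDegree q → 0 < f.coeff (quatDegree q) ^ 2 := by
        intro f hf
        have hf0 : f ≠ 0 := by
          rintro rfl
          exact hm (by simpa using hf.symm)
        rw [← hf]
        exact sq_pos_of_ne_zero (Polynomial.leadingCoeff_ne_zero.2 hf0)
      have hmax : q.re.natDegree = quatDegree q ∨ q.imI.natDegree = quatDegree q ∨
          q.imJ.natDegree = quatDegree q ∨ q.imK.natDegree = quatDegree q := by
        simp only [quatDegree]
        omega
      have s0 := sq_nonneg (q.re.coeff (quatDegree q))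
      have s1 := sq_nonneg (q.imI.coeff (quatDegree q))
      have s2 := sq_nonneg (q.imJ.coeff (quatDegree q))
      have s3 := sq_nonneg (q.imK.coeff (quatDegree q))
      rcases hmax with h | h | h | h <;> linarith [key _ h]

theorem quatDegree_mul {p q : ℍ[ℝ[X]]} (hp : p ≠ 0) (hq : q ≠ 0) :
    quatDegree (p * q) = quatDegree p + quatDegree q := by
  have h := natDegree_normSq (p * q)
  rw [map_mul, Polynomial.natDegree_mul (mt normSq_poly_eq_zero.1 hp)
    (mt normSq_poly_eq_zero.1 hq), natDegree_normSq, natDegree_normSq] at h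
  omega

theorem quatDegree_mul_le (p q : ℍ[ℝ[X]]) : quatDegree (p * q) ≤ quatDegree p + quatDegree q := by
  by_cases hp : p = 0
  · simp [hp, quatDegree]
  by_cases hq : q = 0
  · simp [hq, quatDegree]
  exact (quatDegree_mul hp hq).le

theorem quatDegree_star (q : ℍ[ℝ[X]]) : quatDegree (star q) = quatDegree q := by
  simp [quatDegree]

theorem quatDegree_neg (q : ℍ[ℝ[X]]) : quatDegree (-q) = quatDegree q := by
  simp [quatDegree]

theorem quatDegree_smul {a : ℝ[X]} {q : ℍ[ℝ[X]]} (ha : a ≠ 0) (hq : q ≠ 0) :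
    quatDegree (a • q) = a.natDegree + quatDegree q := by
  have h := natDegree_normSq (a • q)
  rw [normSq_smul_eq, Polynomial.natDegree_mul (pow_ne_zero 2 ha) (mt normSq_poly_eq_zero.1 hq),
    natDegree_normSq, Polynomial.natDegree_pow] at h
  omega

theorem quatDegree_rotK (p : ℍ[ℝ[X]]) : quatDegree (rotK p) = 2 * quatDegree p := by
  have h := natDegree_normSq (rotK p)
  rw [normSq_rotK, Polynomial.natDegree_pow, natDegree_normSq] at h
  omega

theorem quatDegree_add_le {p q : ℍ[ℝ[X]]} {n : ℕ} (hp : quatDegree p ≤ n)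
    (hq : quatDegree q ≤ n) : quatDegree (p + q) ≤ n := by
  rw [quatDegree_le_iff] at *
  simp only [Quaternion.re_add, Quaternion.imI_add, Quaternion.imJ_add, Quaternion.imK_add]
  refine ⟨?_, ?_, ?_, ?_⟩ <;> apply Polynomial.natDegree_add_le_of_degree_le <;> tauto

theorem polyDegree_le_smul {a : ℝ[X]} (ha : a ≠ 0) (w : DualQuat ℝ[X]) :
    polyDegree w ≤ polyDegree (a • w) := by
  have key : ∀ q : ℍ[ℝ[X]], quatDegree q ≤ quatDegree (a • q) := by
    intro q
    by_cases hq : q = 0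
    · simp [hq]
    · rw [quatDegree_smul ha hq]
      omega
  exact max_le_max (key _) (key _)

theorem polyDegree_smul_le (a : ℝ[X]) (w : DualQuat ℝ[X]) :
    polyDegree (a • w) ≤ a.natDegree + polyDegree w := by
  have key : ∀ q : ℍ[ℝ[X]], quatDegree (a • q) ≤ a.natDegree + quatDegree q := by
    intro q
    by_cases hq : q = 0
    · simp [hq, quatDegree]
    by_cases ha : a = 0
    · simp [ha, quatDegree]
    rw [quatDegree_smul ha hq]
  rw [polyDegree, polyDegree, ← Nat.add_max_add_left]
  exact max_le_max (key _) (key _)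

end Degree

/-! ### Polynomial representatives of points -/

section Points

theorem ofPoly_smul (a : ℝ[X]) (w : DualQuat ℝ[X]) : ofPoly (a • w) = toRat a • ofPoly w := by
  apply TrivSqZeroExt.ext <;> ext1 <;> simp [mapQuat]

theorem ofPoly_mul (v w : DualQuat ℝ[X]) : ofPoly (v * w) = ofPoly v * ofPoly w := by
  apply TrivSqZeroExt.ext <;> ext1 <;> simp [mapQuat]

theorem ofPoly_injective : Function.Injective ofPoly := by
  intro v w h
  have h1 := congrArg TrivSqZeroExt.fst h
  have h2 := congrArg TrivSqZeroExt.snd h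
  simp [mapQuat, toRat_injective.eq_iff, Quaternion.ext_iff] at h1 h2
  apply TrivSqZeroExt.ext <;> ext1 <;> tauto

theorem samePoint_ofPoly_of_smul {v w : DualQuat ℝ[X]} {m n : ℝ[X]} (hm : m ≠ 0) (hn : n ≠ 0)
    (h : m • v = n • w) : SamePoint (ofPoly v) (ofPoly w) := by
  refine (samePoint_smul (toRat_ne_zero hm) _).trans (SamePoint.symm
    ⟨toRat n, toRat_ne_zero hn, ?_⟩)
  rw [← ofPoly_smul, ← ofPoly_smul, h]

theorem samePoint_ofPoly_iff {v w : DualQuat ℝ[X]} : SamePoint (ofPoly v) (ofPoly w) ↔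
    ∃ m n : ℝ[X], m ≠ 0 ∧ n ≠ 0 ∧ IsCoprime m n ∧ m • v = n • w := by
  constructor
  · rintro ⟨c, hc, h⟩
    have hd := RatFunc.denom_ne_zero c
    refine ⟨c.num, c.denom, RatFunc.num_ne_zero hc, hd, RatFunc.isCoprime_num_denom c, ?_⟩
    apply ofPoly_injective
    rw [ofPoly_smul, ofPoly_smul, h, smul_smul]
    congr 1
    have h1 : toRat c.num / toRat c.denom = c := RatFunc.num_div_denom c
    replace hd := toRat_ne_zero hd
    field_simp at h1
    exact h1
  · rintro ⟨m, n, hm, hn, -, h⟩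
    exact samePoint_ofPoly_of_smul hm hn h

theorem degree_le {x : DualQuat RealRat} {w : DualQuat ℝ[X]} (h : SamePoint x (ofPoly w)) :
    degree x ≤ polyDegree w := Nat.sInf_le ⟨w, h, rfl⟩

theorem exists_polyDegree_eq_degree (x : DualQuat RealRat) :
    ∃ w : DualQuat ℝ[X], SamePoint x (ofPoly w) ∧ polyDegree w = degree x := by
  apply Nat.sInf_mem (s := {d : ℕ | ∃ w : DualQuat ℝ[X], SamePoint x (ofPoly w) ∧ polyDegree w = d})
  obtain ⟨b, hb, w, hw⟩ := exists_ofPoly x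
  exact ⟨_, w, hw ▸ samePoint_smul (toRat_ne_zero hb) x, rfl⟩

/-- The degree of a point is the degree of any primitive polynomial that represents it, that is,
of a polynomial whose coordinates have no common divisor of positive degree. -/
theorem degree_eq_of_primitive {x : DualQuat RealRat} {w : DualQuat ℝ[X]}
    (h : SamePoint x (ofPoly w)) (hw : ∀ (p : ℝ[X]) (v : DualQuat ℝ[X]), w = p • v → IsUnit p) :
    degree x = polyDegree w := by
  apply le_antisymm (degree_le h)
  obtain ⟨v, hv, hd⟩ := exists_polyDegree_eq_degree x
  rw [← hd]
  obtain ⟨m, n, hm, hn, ⟨a, b, hab⟩, e⟩ := samePoint_ofPoly_iff.1 (h.symm.trans hv)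
  have hunit : IsUnit n := by
    apply hw n (a • v + b • w)
    rw [smul_add, smul_comm n a, ← e, smul_smul, smul_smul, ← add_smul]
    rw [mul_comm n b, hab, one_smul]
  calc polyDegree w ≤ polyDegree (m • w) := polyDegree_le_smul hm w
    _ = polyDegree (n • v) := by rw [e]
    _ ≤ n.natDegree + polyDegree v := polyDegree_smul_le n v
    _ = polyDegree v := by rw [Polynomial.natDegree_eq_zero_of_isUnit hunit, zero_add]

end Points

/-! ### Pairs of real polynomials as complex polynomials -/

section Complex
open Complex

/-- The complex polynomial `a + i b`. It stands for the quaternion polynomial `a + b k`. -/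
noncomputable def cplx (a b : ℝ[X]) : ℂ[X] :=
  a.map ofRealHom + Polynomial.C I * b.map ofRealHom

theorem coeff_cplx (a b : ℝ[X]) (n : ℕ) :
    (cplx a b).coeff n = ⟨a.coeff n, b.coeff n⟩ := by
  apply Complex.ext <;> simp [cplx]

theorem cplx_mul (a b c d : ℝ[X]) :
    cplx a b * cplx c d = cplx (a * c - b * d) (a * d + b * c) := by
  have hI : (Polynomial.C I : ℂ[X]) * Polynomial.C I = -1 := by
    rw [← map_mul, I_mul_I]
    simp
  simp only [cplx, Polynomial.map_add, Polynomial.map_mul, Polynomial.map_sub]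
  linear_combination b.map ofRealHom * d.map ofRealHom * hI

theorem cplx_add (a b c d : ℝ[X]) : cplx a b + cplx c d = cplx (a + c) (b + d) := by
  simp only [cplx, Polynomial.map_add]
  ring

theorem cplx_inj {a b c d : ℝ[X]} (h : cplx a b = cplx c d) : a = c ∧ b = d := by
  have key : ∀ n, a.coeff n = c.coeff n ∧ b.coeff n = d.coeff n := by
    intro n
    have := congrArg (fun p => Polynomial.coeff p n) h
    simpa [coeff_cplx] using this
  exact ⟨Polynomial.ext fun n => (key n).1, Polynomial.ext fun n => (key n).2⟩

theorem exists_cplx (z : ℂ[X]) : ∃ a b, cplx a b = z := by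
  induction z using Polynomial.induction_on' with
  | add p q hp hq =>
    obtain ⟨a, b, rfl⟩ := hp
    obtain ⟨c, d, rfl⟩ := hq
    exact ⟨a + c, b + d, (cplx_add _ _ _ _).symm⟩
  | monomial n z =>
    refine ⟨Polynomial.monomial n z.re, Polynomial.monomial n z.im, ?_⟩
    ext m
    rw [coeff_cplx]
    simp only [Polynomial.coeff_monomial]
    split <;> rfl

theorem natDegree_cplx_le_iff {a b : ℝ[X]} {n : ℕ} :
    (cplx a b).natDegree ≤ n ↔ a.natDegree ≤ n ∧ b.natDegree ≤ n := by
  simp only [Polynomial.natDegree_le_iff_coeff_eq_zero, coeff_cplx, ← forall_and]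
  simp [Complex.ext_iff, imp_and]

end Complex

/-! ### Bézout equations and complex right factors -/

/-- A linear Diophantine equation with coprime coefficients of degree at most `d` has a solution
of degree at most `max d (deg c - d)`. -/
theorem exists_bezout_degree_le {F : Type*} [Field F] {x y : F[X]} (h : IsCoprime x y) (c : F[X]) :
    ∃ a b : F[X], a * x + b * y = c ∧
      a.natDegree ≤ max (max x.natDegree y.natDegree)
        (c.natDegree - max x.natDegree y.natDegree) ∧
      b.natDegree ≤ max (max x.natDegree y.natDegree)
        (c.natDegree - max x.natDegree y.natDegree) := by
  wlog hxy : y.degree ≤ x.degree generalizing x y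
  · obtain ⟨a, b, h1, h2, h3⟩ := this h.symm (le_of_not_ge hxy)
    rw [max_comm y.natDegree] at h2 h3
    exact ⟨b, a, by rw [← h1]; ring, h3, h2⟩
  have hx : x ≠ 0 := by
    rintro rfl
    have hy : y = 0 := by simpa using hxy
    subst hy
    exact not_isCoprime_zero_zero h
  rw [max_eq_left (Polynomial.natDegree_le_natDegree hxy)]
  obtain ⟨u, v, huv⟩ := h
  have hb : (c * v % x).natDegree ≤ x.natDegree :=
    Polynomial.natDegree_le_natDegree (Polynomial.degree_mod_lt _ hx).le
  have hab : (c * u + c * v / x * y) * x + (c * v % x) * y = c := by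
    linear_combination c * huv + y * EuclideanDomain.mod_add_div (c * v) x
  refine ⟨c * u + c * v / x * y, c * v % x, hab, ?_, hb.trans (le_max_left _ _)⟩
  generalize c * u + c * v / x * y = a at *
  by_cases ha : a = 0
  · simp [ha]
  have h1 : (a * x).natDegree ≤ max c.natDegree (2 * x.natDegree) := by
    rw [eq_sub_of_add_eq hab]
    refine (Polynomial.natDegree_sub_le _ _).trans (max_le_max le_rfl ?_)
    refine Polynomial.natDegree_mul_le.trans ?_
    have := Polynomial.natDegree_le_natDegree hxy
    omega
  rw [Polynomial.natDegree_mul ha hx] at h1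
  omega

/-- Every non-zero quaternion polynomial `q` is a product `p (a + b k)` with `p` such that the
left ideal generated by `p` contains an element of the form `1 + r i + s j`. In terms of the
complex polynomials `x`, `y` with `q = x + i y`, where `k` is the imaginary unit, `a + b k` is the
greatest common divisor of `x` and `y`. -/
theorem exists_eq_mul_complex {q : ℍ[ℝ[X]]} (hq : q ≠ 0) :
    ∃ (p m : ℍ[ℝ[X]]) (a b : ℝ[X]), q = p * quat a 0 0 b ∧ (m * p).re = 1 ∧ (m * p).imK = 0 := by
  have hg : EuclideanDomain.gcd (cplx q.re q.imK) (cplx q.imI (-q.imJ)) ≠ 0 := by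
    rw [Ne, EuclideanDomain.gcd_eq_zero_iff]
    rintro ⟨h1, h2⟩
    have h0 : cplx 0 0 = 0 := by simp [cplx]
    rw [← h0] at h1 h2
    have h1 := cplx_inj h1
    have h2 := cplx_inj h2
    rw [neg_eq_zero] at h2
    exact hq (by ext1 <;> simp [h1, h2])
  obtain ⟨x, hx⟩ := EuclideanDomain.gcd_dvd_left (cplx q.re q.imK) (cplx q.imI (-q.imJ))
  obtain ⟨y, hy⟩ := EuclideanDomain.gcd_dvd_right (cplx q.re q.imK) (cplx q.imI (-q.imJ))
  obtain ⟨u, v, hgcd⟩ : ∃ u v, EuclideanDomain.gcd (cplx q.re q.imK) (cplx q.imI (-q.imJ)) =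
      cplx q.re q.imK * u + cplx q.imI (-q.imJ) * v :=
    ⟨_, _, EuclideanDomain.gcd_eq_gcd_ab _ _⟩
  generalize EuclideanDomain.gcd (cplx q.re q.imK) (cplx q.imI (-q.imJ)) = g at *
  have huv : x * u + y * v = 1 := by
    apply mul_left_cancel₀ hg
    linear_combination -hgcd - u * hx - v * hy
  obtain ⟨a, b, rfl⟩ := exists_cplx g
  obtain ⟨x0, x1, rfl⟩ := exists_cplx x
  obtain ⟨y0, y1, rfl⟩ := exists_cplx y
  obtain ⟨u0, u1, rfl⟩ := exists_cplx u
  obtain ⟨v0, v1, rfl⟩ := exists_cplx v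
  have h1 : (1 : ℂ[X]) = cplx 1 0 := by simp [cplx]
  rw [cplx_mul] at hx hy
  rw [cplx_mul, cplx_mul, cplx_add, h1] at huv
  obtain ⟨hx0, hx1⟩ := cplx_inj hx
  obtain ⟨hy0, hy1⟩ := cplx_inj hy
  obtain ⟨e0, e1⟩ := cplx_inj huv
  refine ⟨quat x0 y0 (-y1) x1, quat u0 (-v0) (-v1) u1, a, b, ?_, ?_, ?_⟩
  · ext1 <;> simp
    · rw [hx0]; ring
    · rw [hy0]; ring
    · linear_combination -hy1
    · rw [hx1]; ring
  · simp
    linear_combination e0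
  · simp
    linear_combination e1

/-- The factor `d` with prescribed complex part `c k` of `d p` can be chosen of small degree. -/
theorem exists_mul_imK_eq {p m : ℍ[ℝ[X]]} (hr : (m * p).re = 1) (hk : (m * p).imK = 0)
    (c : ℝ[X]) : ∃ d : ℍ[ℝ[X]], (d * p).re = 0 ∧ (d * p).imK = c ∧
      quatDegree d ≤ max (quatDegree p) (c.natDegree - quatDegree p) := by
  have hco : IsCoprime (cplx p.re p.imK) (cplx p.imI (-p.imJ)) := by
    refine ⟨cplx m.re m.imK, cplx (-m.imI) (-m.imJ), ?_⟩
    have h1 : (1 : ℂ[X]) = cplx 1 0 := by simp [cplx]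
    rw [cplx_mul, cplx_mul, cplx_add, h1]
    rw [Quaternion.re_mul] at hr
    rw [Quaternion.imK_mul] at hk
    congr 1
    · linear_combination hr
    · linear_combination hk
  obtain ⟨x, y, h, hx, hy⟩ := exists_bezout_degree_le hco (cplx 0 c)
  obtain ⟨x0, x1, rfl⟩ := exists_cplx x
  obtain ⟨y0, y1, rfl⟩ := exists_cplx y
  have hdeg : max (cplx p.re p.imK).natDegree (cplx p.imI (-p.imJ)).natDegree = quatDegree p := by
    apply eq_of_forall_ge_iff
    intro n
    rw [max_le_iff, natDegree_cplx_le_iff, natDegree_cplx_le_iff, quatDegree_le_iff,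
      Polynomial.natDegree_neg]
    tauto
  have hc : (cplx 0 c).natDegree ≤ c.natDegree := natDegree_cplx_le_iff.2 (by simp)
  rw [hdeg] at hx hy
  replace hx := hx.trans (max_le_max le_rfl (Nat.sub_le_sub_right hc _))
  replace hy := hy.trans (max_le_max le_rfl (Nat.sub_le_sub_right hc _))
  rw [natDegree_cplx_le_iff] at hx hy
  rw [cplx_mul, cplx_mul, cplx_add] at h
  obtain ⟨h0, h1⟩ := cplx_inj h
  refine ⟨quat x0 (-y0) (-y1) x1, ?_, ?_, ?_⟩
  · simp
    linear_combination h0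
  · simp
    linear_combination h1
  · rw [quatDegree_le_iff]
    simp only [quat_re, quat_imI, quat_imJ, quat_imK, Polynomial.natDegree_neg]
    tauto

/-! ### Normal form of a torse with rational Gauss map -/

section NormalForm

theorem ne_zero_of_bezout {p m : ℍ[ℝ[X]]} (hr : (m * p).re = 1) : p ≠ 0 := by
  rintro rfl
  simp at hr

theorem rotK_ne_zero {p : ℍ[ℝ[X]]} (hp : p ≠ 0) : rotK p ≠ 0 := by
  refine mt normSq_poly_eq_zero.2 ?_
  rw [normSq_rotK]
  exact pow_ne_zero 2 (mt normSq_poly_eq_zero.1 hp)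

theorem rotK_mul_complex (p : ℍ[ℝ[X]]) (a b : ℝ[X]) :
    rotK (p * quat a 0 0 b) = (a ^ 2 + b ^ 2) • rotK p := by
  have h : rotK (quat a 0 0 b) = (a ^ 2 + b ^ 2) • quat 0 0 0 1 := by
    ext1 <;> simp [rotK] <;> ring
  rw [rotK_mul, h, quat_mul_smul, quat_smul_mul, rotK]

theorem mapQuat_mul (p q : ℍ[ℝ[X]]) :
    mapQuat toRat (p * q) = mapQuat toRat p * mapQuat toRat q := by
  ext1 <;> simp [mapQuat]

theorem mapQuat_smul (a : ℝ[X]) (q : ℍ[ℝ[X]]) :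
    mapQuat toRat (a • q) = toRat a • mapQuat toRat q := by
  ext1 <;> simp [mapQuat]

theorem mapQuat_star (q : ℍ[ℝ[X]]) : mapQuat toRat (star q) = star (mapQuat toRat q) := by
  ext1 <;> simp [mapQuat]

theorem mapQuat_rotK (q : ℍ[ℝ[X]]) : mapQuat toRat (rotK q) = rotK (mapQuat toRat q) := by
  simp only [rotK, mapQuat_mul, mapQuat_star]
  congr 2
  ext1 <;> simp [mapQuat]

theorem mapQuat_injective : Function.Injective (mapQuat toRat) := by
  intro p q h
  simp [mapQuat, toRat_injective.eq_iff, Quaternion.ext_iff] at h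
  ext1 <;> tauto

theorem normSq_mapQuat (q : ℍ[ℝ[X]]) :
    Quaternion.normSq (mapQuat toRat q) = toRat (Quaternion.normSq q) := by
  simp [normSq_eq, mapQuat]

/-- If the left ideal generated by `p` contains an element of the form `1 + r i + s j`, then the
coordinates of `p k p*` have no common factor. -/
theorem dvd_of_smul_rotK_eq {p m : ℍ[ℝ[X]]} (hr : (m * p).re = 1) (hk : (m * p).imK = 0)
    {g q : ℝ[X]} {v : ℍ[ℝ[X]]} (h : g • rotK p = q • v) : q ∣ 2 * g := by
  have h1 : g • rotK (m * p) = q • (m * v * star m) := by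
    rw [rotK_mul, ← quat_smul_mul, ← quat_mul_smul, h, quat_mul_smul, quat_smul_mul]
  have hI := congrArg (fun x => x.imI) h1
  have hJ := congrArg (fun x => x.imJ) h1
  have hK := congrArg (fun x => x.imK) h1
  simp only [Quaternion.imI_smul, Quaternion.imJ_smul, Quaternion.imK_smul, smul_eq_mul] at hI hJ hK
  generalize m * v * star m = z at *
  generalize m * p = y at *
  simp [rotK, hr, hk] at hI hJ hK
  refine ⟨2 * z.imK + y.imJ * z.imI - y.imI * z.imJ, ?_⟩
  linear_combination 2 * hK + y.imJ * hI - y.imI * hJ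

theorem isUnit_of_dvd_two {q : ℝ[X]} (h : q ∣ 2) : IsUnit q := by
  refine isUnit_of_dvd_unit h ?_
  have : (2 : ℝ[X]) = Polynomial.C 2 := rfl
  rw [this, Polynomial.isUnit_C]
  exact isUnit_iff_ne_zero.2 two_ne_zero

/-- The torse polynomial `g p k p* + ε u₀`. -/
noncomputable def torsePoly (g u₀ : ℝ[X]) (p : ℍ[ℝ[X]]) : DualQuat ℝ[X] :=
  mk (g • rotK p) (quat u₀ 0 0 0)

theorem degree_torse {u : DualQuat RealRat} {g u₀ : ℝ[X]} {p m : ℍ[ℝ[X]]} (hg : g ≠ 0)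
    (hco : IsCoprime g u₀) (hr : (m * p).re = 1) (hk : (m * p).imK = 0)
    (hu : SamePoint u (ofPoly (torsePoly g u₀ p))) :
    degree u = max (g.natDegree + 2 * quatDegree p) u₀.natDegree := by
  rw [degree_eq_of_primitive hu]
  · rw [polyDegree, torsePoly, fst_mk, snd_mk,
      quatDegree_smul hg (rotK_ne_zero (ne_zero_of_bezout hr)), quatDegree_rotK]
    simp [quatDegree]
  · intro q v h
    have h1 := congrArg TrivSqZeroExt.fst h
    have h2 := congrArg (fun x => x.snd.re) h
    simp [torsePoly] at h1 h2
    have h3 := dvd_of_smul_rotK_eq hr hk h1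
    obtain ⟨x, y, hxy⟩ := hco
    apply isUnit_of_dvd_two
    have : (2 : ℝ[X]) = x * (2 * g) + 2 * y * u₀ := by linear_combination -2 * hxy
    rw [this]
    exact dvd_add (Dvd.dvd.mul_left h3 _) (Dvd.dvd.mul_left ⟨_, h2⟩ _)

theorem degree_gaussMap {u : DualQuat RealRat} {n : ℍ[RealRat]} {g u₀ : ℝ[X]} {p m : ℍ[ℝ[X]]}
    (hg : g ≠ 0) (hr : (m * p).re = 1) (hk : (m * p).imK = 0)
    (hu : SamePoint u (ofPoly (torsePoly g u₀ p))) (hn : IsGaussMap u n) :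
    degree (curveOf n) = 2 * quatDegree p := by
  have hp := ne_zero_of_bezout hr
  have hN : Quaternion.normSq p ≠ 0 := mt normSq_poly_eq_zero.1 hp
  obtain ⟨c, hc, h⟩ := hu.symm
  obtain ⟨s, hs, hs2, hns⟩ := hn
  have h1 : u.fst = (c * toRat g) • mapQuat toRat (rotK p) := by
    rw [h]
    simp [torsePoly, mapQuat_smul, smul_smul]
  have h2 : s ^ 2 = (c * toRat g * toRat (Quaternion.normSq p)) ^ 2 := by
    rw [hs2, h1, normSq_smul_eq, normSq_mapQuat, normSq_rotK, map_pow]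
    ring
  have hcg := mul_ne_zero hc (toRat_ne_zero hg)
  have hN' := toRat_ne_zero hN
  obtain ⟨e, he, hes⟩ : ∃ e : ℝ[X], e ^ 2 = 1 ∧
      s = toRat e * (c * toRat g * toRat (Quaternion.normSq p)) := by
    rcases sq_eq_sq_iff_eq_or_eq_neg.1 h2 with h | h
    · exact ⟨1, by simp, by simpa using h⟩
    · exact ⟨-1, by simp, by simpa using h⟩
  have he0 : e ≠ 0 := by
    rintro rfl
    simp at he
  have he' : toRat e * toRat e = 1 := by
    rw [← map_mul, ← pow_two, he, map_one]
  have hsame : SamePoint (curveOf n)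
      (ofPoly (mk (quat (Quaternion.normSq p) 0 0 0) (e • rotK p))) := by
    refine ⟨toRat (Quaternion.normSq p), hN', ?_⟩
    have h3 : toRat (Quaternion.normSq p) • n = toRat e • mapQuat toRat (rotK p) := by
      rw [hns, h1, smul_smul, smul_smul]
      congr 1
      rw [hes]
      have := toRat_ne_zero he0
      have := toRat_ne_zero hg
      field_simp
      rw [pow_two, he']
    apply TrivSqZeroExt.ext
    · ext1 <;> simp [mapQuat, curveOf]
    · simp [curveOf, h3, mapQuat_smul]
  rw [degree_eq_of_primitive hsame]
  · have hd : e.natDegree = 0 := by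
      have := congrArg Polynomial.natDegree he
      rw [Polynomial.natDegree_pow, Polynomial.natDegree_one] at this
      omega
    rw [polyDegree, fst_mk, snd_mk, quatDegree_smul he0 (rotK_ne_zero hp), quatDegree_rotK, hd]
    have h1 : quatDegree (quat (Quaternion.normSq p) 0 0 0) = 2 * quatDegree p := by
      rw [← natDegree_normSq]
      simp [quatDegree]
    rw [h1, zero_add, max_self]
  · intro q v h
    have h1 := congrArg TrivSqZeroExt.snd h
    simp at h1
    have h3 := dvd_of_smul_rotK_eq hr hk h1
    apply isUnit_of_dvd_two
    have : (2 : ℝ[X]) = e * (2 * e) := by linear_combination -2 * he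
    rw [this]
    exact Dvd.dvd.mul_left h3 _

/-- A torse with rational Gauss map is represented by a polynomial `g p k p* + ε u₀` with coprime
`g` and `u₀` such that the coordinates of `p k p*` have no common factor. The quaternion `v + s k`
with `s² = N(v)` describes a half-turn that interchanges `k` and `v / s`; clearing denominators and
splitting off the right factor in `ℝ[t][k]` turns it into `p`. -/
theorem exists_normalForm {u : DualQuat RealRat} (hu : IsTorse u) {n : ℍ[RealRat]}
    (hn : IsGaussMap u n) :
    ∃ (g u₀ : ℝ[X]) (p m : ℍ[ℝ[X]]), g ≠ 0 ∧ IsCoprime g u₀ ∧ (m * p).re = 1 ∧ (m * p).imK = 0 ∧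
      SamePoint u (ofPoly (torsePoly g u₀ p)) := by
  obtain ⟨-, hre, him⟩ := hu
  obtain ⟨s, hs, hs2, -⟩ := hn
  -- one of the two square roots of `N(v)` differs from `-v₃`
  wlog hv : u.fst.imK + s ≠ 0 generalizing s
  · refine this (-s) (neg_ne_zero.2 hs) (by rw [neg_sq, hs2]) fun h0 => hs ?_
    have h1 : u.fst.imK + s = 0 := by simpa using hv
    linear_combination (1 / 2 : RealRat) * h1 - (1 / 2 : RealRat) * h0
  rw [normSq_eq, hre] at hs2
  set q₀ : ℍ[RealRat] := u.fst + quat 0 0 0 s with hq₀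
  have hrot : rotK q₀ = (2 * (u.fst.imK + s)) • u.fst := by
    ext1 <;> simp [rotK, hq₀, hre]
    · ring
    · ring
    · ring
    · linear_combination hs2
  obtain ⟨b, hb, w, hw⟩ := exists_ofPoly (mk q₀ 0)
  have hw1 : mapQuat toRat w.fst = toRat b • q₀ := by
    simpa using congrArg TrivSqZeroExt.fst hw
  have hw0 : w.fst ≠ 0 := by
    intro h0
    have h1 := congrArg (fun x => x.imK) hw1
    simp [h0, mapQuat, hq₀] at h1
    refine mul_ne_zero (toRat_ne_zero hb) hv ?_
    linear_combination -h1
  obtain ⟨p, m, a, c, hpa, hr, hk⟩ := exists_eq_mul_complex hw0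
  have hac : a ^ 2 + c ^ 2 ≠ 0 := by
    intro h0
    obtain ⟨rfl, rfl⟩ := poly_eq_zero_of_sq_add_sq h0
    apply hw0
    rw [hpa]
    ext1 <;> simp
  have hrot1 : rotK w.fst = (a ^ 2 + c ^ 2) • rotK p := by
    rw [hpa, rotK_mul_complex]
  -- the vector part of `u` is a rational multiple of `p k p*`
  obtain ⟨r, hr0, hur⟩ : ∃ r : RealRat, r ≠ 0 ∧ u.fst = r • mapQuat toRat (rotK p) := by
    have h1 : toRat (a ^ 2 + c ^ 2) • mapQuat toRat (rotK p) =
        (toRat b ^ 2 * (2 * (u.fst.imK + s))) • u.fst := by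
      rw [← mapQuat_smul, ← hrot1, mapQuat_rotK, hw1, rotK_smul, hrot, smul_smul]
    have h2 : toRat b ^ 2 * (2 * (u.fst.imK + s)) ≠ 0 :=
      mul_ne_zero (pow_ne_zero 2 (toRat_ne_zero hb)) (mul_ne_zero two_ne_zero hv)
    refine ⟨(toRat b ^ 2 * (2 * (u.fst.imK + s)))⁻¹ * toRat (a ^ 2 + c ^ 2),
      mul_ne_zero (inv_ne_zero h2) (toRat_ne_zero hac), ?_⟩
    rw [← smul_smul, h1, smul_smul, inv_mul_cancel₀ h2, one_smul]
  have hu0 : u.snd = quat u.snd.re 0 0 0 := by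
    simp [Quaternion.ext_iff] at him
    ext1 <;> simp [him]
  obtain ⟨e, he, f, hf⟩ := exists_common_denom ![r, u.snd.re]
  have f0 := hf 0
  have f1 := hf 1
  simp at f0 f1
  have hf0 : f 0 ≠ 0 := by
    refine mt toRat_eq_zero.2 ?_
    rw [f0]
    exact mul_ne_zero (toRat_ne_zero he) hr0
  obtain ⟨x, y, h, hh, hxy, hx, hy⟩ : ∃ x y h : ℝ[X], h ≠ 0 ∧ IsCoprime x y ∧ f 0 = h * x ∧
      f 1 = h * y := by
    obtain ⟨x, hx⟩ := EuclideanDomain.gcd_dvd_left (f 0) (f 1)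
    obtain ⟨y, hy⟩ := EuclideanDomain.gcd_dvd_right (f 0) (f 1)
    have hg : EuclideanDomain.gcd (f 0) (f 1) ≠ 0 := fun h0 =>
      hf0 (EuclideanDomain.gcd_eq_zero_iff.1 h0).1
    obtain ⟨i, j, hij⟩ : ∃ i j, EuclideanDomain.gcd (f 0) (f 1) = f 0 * i + f 1 * j :=
      ⟨_, _, EuclideanDomain.gcd_eq_gcd_ab _ _⟩
    refine ⟨x, y, _, hg, ⟨i, j, ?_⟩, hx, hy⟩
    apply mul_left_cancel₀ hg
    linear_combination -hij - i * hx - j * hy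
  refine ⟨x, y, p, m, ?_, hxy, hr, hk, ?_⟩
  · rintro rfl
    simp [hx] at hf0
  · refine SamePoint.trans ⟨toRat e, toRat_ne_zero he, ?_⟩
      (samePoint_smul (toRat_ne_zero hh) (ofPoly (torsePoly x y p))).symm
    rw [← ofPoly_smul]
    apply TrivSqZeroExt.ext
    · rw [ofPoly_fst, TrivSqZeroExt.fst_smul, TrivSqZeroExt.fst_smul, hur, torsePoly, fst_mk,
        smul_smul, smul_smul (toRat e), ← f0, hx, ← mapQuat_smul]
    · rw [ofPoly_snd, TrivSqZeroExt.snd_smul, TrivSqZeroExt.snd_smul, hu0, torsePoly, snd_mk]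
      ext1 <;> simp [mapQuat, ← f1, hy]

theorem isKinematic_iff {u : DualQuat RealRat} (hu : IsTorse u) (hvec : u.fst ≠ 0) :
    IsKinematic u ↔ ∃ n : ℍ[RealRat], IsGaussMap u n := by
  constructor
  · rintro ⟨w, hw, s, hs⟩
    obtain ⟨t, ht⟩ : ∃ t, t = s ^ 2 := ⟨_, rfl⟩
    rw [← ht] at hs
    obtain ⟨c, hc, h⟩ := hw.symm
    have h1 := congrArg (fun x => x.fst.re) hs
    have h2 : Quaternion.normSq w.fst = s ^ 2 := by
      simp [conj] at h1
      rw [normSq_eq, ← ht]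
      linear_combination h1
    have h3 : (c * toRat s) ^ 2 = Quaternion.normSq u.fst := by
      rw [h, TrivSqZeroExt.fst_smul, normSq_smul_eq, ofPoly_fst, normSq_mapQuat, h2, map_pow]
      ring
    refine ⟨_, c * toRat s, ?_, h3, rfl⟩
    intro h0
    rw [h0, zero_pow two_ne_zero] at h3
    exact hvec (normSq_rat_eq_zero.1 h3.symm)
  · rintro ⟨n, hn⟩
    obtain ⟨g, u₀, p, m, hg, hco, hr, hk, hs⟩ := exists_normalForm hu hn
    refine ⟨_, hs, g * Quaternion.normSq p, ?_⟩
    have hre : (rotK p).re = 0 := by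
      simp [rotK]
      ring
    have h1 : (g • rotK p) * star (g • rotK p) =
        (((g * Quaternion.normSq p) ^ 2 : ℝ[X]) : ℍ[ℝ[X]]) := by
      rw [mul_star_self_eq, normSq_smul_eq, normSq_rotK, ← mul_pow]
      generalize (g * Quaternion.normSq p) ^ 2 = t
      ext1 <;> simp
    apply TrivSqZeroExt.ext
    · simpa [torsePoly, conj] using h1
    · ext1 <;> simp [torsePoly, conj, hre] <;> ring

end NormalForm

/-! ### Motion polynomials with a given trajectory -/

section Motions

theorem imageOfK_ofPoly (w : DualQuat ℝ[X]) : imageOfK (ofPoly w) =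
    ofPoly (mk (rotK w.fst) (quat (2 * (w.fst * quat 0 0 0 1 * star w.snd).re) 0 0 0)) := by
  have h2 : toRat 2 = 2 := map_ofNat toRat 2
  rw [imageOfK_eq]
  apply TrivSqZeroExt.ext
  · simp [mapQuat_rotK]
  · ext1 <;> simp [mapQuat, h2]

theorem isMotion_ofPoly_iff (w : DualQuat ℝ[X]) :
    IsMotion (ofPoly w) ↔ w.fst ≠ 0 ∧ (w.fst * star w.snd).re = 0 := by
  have h0 : mapQuat toRat 0 = 0 := by ext1 <;> simp [mapQuat]
  rw [IsMotion, study_expr, ofPoly_fst, ofPoly_snd, ← mapQuat_star, ← mapQuat_mul, ← h0, Ne,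
    mapQuat_injective.eq_iff]
  refine and_congr_right fun _ => ?_
  rw [h0, Quaternion.ext_iff]
  simp [mapQuat, -Quaternion.re_mul]

theorem hasTrajectory_ofPoly_iff (w : DualQuat ℝ[X]) (g u₀ : ℝ[X]) (p : ℍ[ℝ[X]]) :
    HasTrajectory (ofPoly w) (ofPoly (torsePoly g u₀ p)) ↔
      w.fst ≠ 0 ∧ (w.fst * star w.snd).re = 0 ∧ ∃ m n : ℝ[X], m ≠ 0 ∧ n ≠ 0 ∧
        m • rotK w.fst = n • (g • rotK p) ∧
        m * (2 * (w.fst * quat 0 0 0 1 * star w.snd).re) = n * u₀ := by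
  rw [HasTrajectory, isMotion_ofPoly_iff, and_assoc, imageOfK_ofPoly, samePoint_ofPoly_iff]
  refine and_congr_right fun _ => and_congr_right fun _ => ?_
  have key : ∀ m n : ℝ[X], m • mk (rotK w.fst)
        (quat (2 * (w.fst * quat 0 0 0 1 * star w.snd).re) 0 0 0) = n • torsePoly g u₀ p ↔
      m • rotK w.fst = n • (g • rotK p) ∧
        m * (2 * (w.fst * quat 0 0 0 1 * star w.snd).re) = n * u₀ := by
    intro m n
    rw [TrivSqZeroExt.ext_iff, TrivSqZeroExt.fst_smul, TrivSqZeroExt.fst_smul,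
      TrivSqZeroExt.snd_smul, TrivSqZeroExt.snd_smul, torsePoly, fst_mk, fst_mk, snd_mk, snd_mk]
    refine and_congr_right fun _ => ?_
    rw [Quaternion.ext_iff]
    simp only [Quaternion.re_smul, Quaternion.imI_smul, Quaternion.imJ_smul, Quaternion.imK_smul,
      quat_re, quat_imI, quat_imJ, quat_imK, smul_eq_mul, mul_zero, and_true]
  constructor
  · rintro ⟨m, n, hm, hn, -, h⟩
    exact ⟨m, n, hm, hn, (key m n).1 h⟩
  · rintro ⟨m, n, hm, hn, h⟩
    exact samePoint_ofPoly_iff.1 (samePoint_ofPoly_of_smul hm hn ((key m n).2 h))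

/-- The half-turn around the first coordinate axis, which reverses the orientation of `k`. -/
noncomputable def halfTurn : DualQuat ℝ[X] := mk (quat 0 1 0 0) 0

/-- The motion polynomial `(g p + ε d) (a + b k) + ε p (l₁ i + l₂ j)`. It has trajectory
`[g p k p* + ε u₀]` if the complex part of `d* p` is `-u₀ k / 2`. -/
noncomputable def motionPoly (g : ℝ[X]) (p d : ℍ[ℝ[X]]) (a b l₁ l₂ : ℝ[X]) : DualQuat ℝ[X] :=
  mk (g • (p * quat a 0 0 b)) (d * quat a 0 0 b + p * quat 0 l₁ l₂ 0)

/-- The motions with trajectory `[g p k p* + ε u₀]` whose primal part is `p` times an element of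
`ℝ(t)[k]`. -/
theorem exists_eq_motionPoly_of_complex {w : DualQuat ℝ[X]} {g u₀ : ℝ[X]} {p m d : ℍ[ℝ[X]]}
    (hg : g ≠ 0) (hco : IsCoprime g u₀) (hr : (m * p).re = 1) (hk : (m * p).imK = 0)
    (hd0 : (star d * p).re = 0) (hd3 : 2 * (star d * p).imK = -u₀)
    (hw : HasTrajectory (ofPoly w) (ofPoly (torsePoly g u₀ p)))
    (hI : (star p * w.fst).imI = 0) (hJ : (star p * w.fst).imJ = 0) :
    ∃ a b l₁ l₂ : ℝ[X], (a ≠ 0 ∨ b ≠ 0) ∧ w = motionPoly g p d a b l₁ l₂ := by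
  have hp := ne_zero_of_bezout hr
  have hN : Quaternion.normSq p ≠ 0 := mt normSq_poly_eq_zero.1 hp
  obtain ⟨h0, hs, M, n, hM, hn, h1, h2⟩ := (hasTrajectory_ofPoly_iff w g u₀ p).1 hw
  have hfst := eq_mul_of_star_mul_complex hN hr hk hI hJ
  generalize (m * w.fst).re = a at hfst
  generalize (m * w.fst).imK = b at hfst
  rw [hfst] at h0 hs h1 h2
  rw [rotK_mul_complex] at h1
  have h3 : M * (a ^ 2 + b ^ 2) = n * g := by
    by_contra hne
    apply hne
    have h4 : (M * (a ^ 2 + b ^ 2) - n * g) • rotK p = (0 : ℝ[X]) • rotK p := by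
      rw [sub_smul, ← smul_smul, ← smul_smul, h1, sub_self, zero_smul]
    have h5 : (M * (a ^ 2 + b ^ 2) - n * g) ^ 2 * Quaternion.normSq (rotK p) = 0 := by
      rw [← normSq_smul_eq, h4, zero_smul, map_zero]
    rcases mul_eq_zero.1 h5 with h | h
    · exact sub_eq_zero.1 (pow_eq_zero_iff two_ne_zero |>.1 h)
    · exact absurd (normSq_poly_eq_zero.1 h) (rotK_ne_zero hp)
  have e1 : a * (star w.snd * p).re - b * (star w.snd * p).imK = 0 := by
    simp at hs ⊢
    linear_combination hs
  have e2 : M * (2 * (-b * (star w.snd * p).re - a * (star w.snd * p).imK)) = n * u₀ := by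
    simp at h2 ⊢
    linear_combination h2
  -- multiplication of `(a + b k) (w.snd* p) = -(n u₀ / (2 M)) k` by the conjugate of `a + b k`
  have e3 : 2 * g * (star w.snd * p).re = -(u₀ * b) := by
    apply mul_left_cancel₀ hn
    linear_combination -2 * (star w.snd * p).re * h3 - b * e2 + 2 * M * a * e1
  have e4 : 2 * g * (star w.snd * p).imK = -(u₀ * a) := by
    apply mul_left_cancel₀ hn
    linear_combination -2 * (star w.snd * p).imK * h3 - a * e2 - 2 * M * b * e1
  obtain ⟨b', rfl⟩ : g ∣ b := hco.dvd_of_dvd_mul_left ⟨-(2 * (star w.snd * p).re), by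
    linear_combination e3⟩
  obtain ⟨a', rfl⟩ : g ∣ a := hco.dvd_of_dvd_mul_left ⟨-(2 * (star w.snd * p).imK), by
    linear_combination e4⟩
  have e5 : 2 * (star w.snd * p).re = -(u₀ * b') := by
    apply mul_left_cancel₀ hg
    linear_combination e3
  have e6 : 2 * (star w.snd * p).imK = -(u₀ * a') := by
    apply mul_left_cancel₀ hg
    linear_combination e4
  -- the complex part of `w.snd* p` is that of `(d (a' + b' k))* p`
  have z0 : 2 * (star p * (w.snd - d * quat a' 0 0 b')).re = 0 := by
    simp [-mul_eq_zero] at e5 e6 hd0 hd3 ⊢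
    linear_combination e5 - 2 * a' * hd0 - b' * hd3
  have z3 : 2 * (star p * (w.snd - d * quat a' 0 0 b')).imK = 0 := by
    simp [-mul_eq_zero] at e5 e6 hd0 hd3 ⊢
    linear_combination -e6 - 2 * b' * hd0 + a' * hd3
  replace z0 := (mul_eq_zero.1 z0).resolve_left two_ne_zero
  replace z3 := (mul_eq_zero.1 z3).resolve_left two_ne_zero
  obtain ⟨l₁, l₂, hsnd⟩ : ∃ l₁ l₂, w.snd - d * quat a' 0 0 b' = p * quat 0 l₁ l₂ 0 :=
    ⟨_, _, eq_mul_of_star_mul_noncomplex hN hr hk z0 z3⟩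
  refine ⟨a', b', l₁, l₂, ?_, ?_⟩
  rotate_left
  · apply TrivSqZeroExt.ext
    · rw [hfst, motionPoly, fst_mk, ← quat_mul_smul]
      congr 1
      ext1 <;> simp
    · rw [motionPoly, snd_mk, ← hsnd]
      abel
  · by_contra! hc
    apply h0
    rw [hc.1, hc.2]
    ext1 <;> simp

theorem HasTrajectory.mul_halfTurn {w : DualQuat ℝ[X]} {g u₀ : ℝ[X]} {p : ℍ[ℝ[X]]}
    (hw : HasTrajectory (ofPoly w) (ofPoly (torsePoly g u₀ p))) :
    HasTrajectory (ofPoly (w * halfTurn)) (ofPoly (torsePoly g u₀ p)) := by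
  obtain ⟨h0, hs, M, n, hM, hn, h1, h2⟩ := (hasTrajectory_ofPoly_iff w g u₀ p).1 hw
  have e1 : (w * halfTurn).fst = w.fst * quat 0 1 0 0 := by simp [halfTurn]
  have e2 : (w * halfTurn).snd = w.snd * quat 0 1 0 0 := by simp [halfTurn]
  rw [hasTrajectory_ofPoly_iff, e1, e2]
  have hi : rotK (quat 0 1 0 0 : ℍ[ℝ[X]]) = (-1 : ℝ[X]) • quat 0 0 0 1 := by
    ext1 <;> simp [rotK]
  refine ⟨mul_ne_zero h0 ?_, ?_, -M, n, neg_ne_zero.2 hM, hn, ?_, ?_⟩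
  · intro h
    simpa using congrArg (fun x => x.imI) h
  · simp at hs ⊢
    linear_combination hs
  · rw [← h1, rotK_mul, hi, quat_mul_smul, quat_smul_mul, smul_smul, neg_mul_neg, mul_one]
    rfl
  · simp at h2 ⊢
    linear_combination h2

/-- The polynomials representing motions with trajectory `[g p k p* + ε u₀]`: up to a half-turn
they form the family `motionPoly`. -/
theorem exists_eq_motionPoly {w : DualQuat ℝ[X]} {g u₀ : ℝ[X]} {p m d : ℍ[ℝ[X]]}
    (hg : g ≠ 0) (hco : IsCoprime g u₀) (hr : (m * p).re = 1) (hk : (m * p).imK = 0)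
    (hd0 : (star d * p).re = 0) (hd3 : 2 * (star d * p).imK = -u₀)
    (hw : HasTrajectory (ofPoly w) (ofPoly (torsePoly g u₀ p))) :
    ∃ a b l₁ l₂ : ℝ[X], (a ≠ 0 ∨ b ≠ 0) ∧
      (w = motionPoly g p d a b l₁ l₂ ∨ w * halfTurn = motionPoly g p d a b l₁ l₂) := by
  obtain ⟨h0, hs, M, n, hM, hn, h1, h2⟩ := (hasTrajectory_ofPoly_iff w g u₀ p).1 hw
  have h3 : M • rotK (star p * w.fst) =
      (n * g * Quaternion.normSq p ^ 2) • (quat 0 0 0 1 : ℍ[ℝ[X]]) := by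
    have h4 : star p * rotK p * p = (Quaternion.normSq p ^ 2) • quat 0 0 0 1 := by
      calc star p * rotK p * p = (star p * p) * quat 0 0 0 1 * (star p * p) := by
            simp only [rotK, mul_assoc]
        _ = _ := by
          rw [star_mul_self_eq, quat_smul_mul, quat_smul_mul, quat_mul_smul, smul_smul, one_mul,
            mul_one, pow_two]
    calc M • rotK (star p * w.fst) = star p * (M • rotK w.fst) * p := by
          rw [rotK_mul, star_star, quat_mul_smul, quat_smul_mul]
      _ = _ := by
          rw [h1, quat_mul_smul, quat_mul_smul, quat_smul_mul, quat_smul_mul, h4, smul_smul,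
            smul_smul]
  have hI : (rotK (star p * w.fst)).imI = 0 := by
    have := congrArg (fun x => x.imI) h3
    simp only [Quaternion.imI_smul, quat_imI, smul_eq_mul, mul_zero] at this
    exact (mul_eq_zero.1 this).resolve_left hM
  have hJ : (rotK (star p * w.fst)).imJ = 0 := by
    have := congrArg (fun x => x.imJ) h3
    simp only [Quaternion.imJ_smul, quat_imJ, smul_eq_mul, mul_zero] at this
    exact (mul_eq_zero.1 this).resolve_left hM
  rcases complex_or_of_rotK (fun a b h => poly_eq_zero_of_sq_add_sq h) _ hI hJ with
    ⟨ha, hb⟩ | ⟨ha, hb⟩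
  · obtain ⟨a, b, l₁, l₂, hab, h⟩ :=
      exists_eq_motionPoly_of_complex hg hco hr hk hd0 hd3 hw ha hb
    exact ⟨a, b, l₁, l₂, hab, Or.inl h⟩
  · have e1 : (w * halfTurn).fst = w.fst * quat 0 1 0 0 := by simp [halfTurn]
    obtain ⟨a, b, l₁, l₂, hab, h⟩ :=
      exists_eq_motionPoly_of_complex hg hco hr hk hd0 hd3 hw.mul_halfTurn
        (by rw [e1, ← mul_assoc, Quaternion.imI_mul, ha, hb]; simp)
        (by rw [e1, ← mul_assoc, Quaternion.imJ_mul, ha, hb]; simp)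
    exact ⟨a, b, l₁, l₂, hab, Or.inr h⟩

theorem hasTrajectory_motionPoly {g u₀ : ℝ[X]} {p m d : ℍ[ℝ[X]]} (hg : g ≠ 0)
    (hr : (m * p).re = 1) (hd0 : (star d * p).re = 0) (hd3 : 2 * (star d * p).imK = -u₀)
    {a b : ℝ[X]} (hab : a ≠ 0 ∨ b ≠ 0) (l₁ l₂ : ℝ[X]) :
    HasTrajectory (ofPoly (motionPoly g p d a b l₁ l₂)) (ofPoly (torsePoly g u₀ p)) := by
  have hN : a ^ 2 + b ^ 2 ≠ 0 := fun h => by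
    obtain ⟨rfl, rfl⟩ := poly_eq_zero_of_sq_add_sq h
    simp at hab
  have hz : quat a 0 0 b ≠ 0 := fun h => by
    have h1 := congrArg (fun x => x.re) h
    have h2 := congrArg (fun x => x.imK) h
    simp at h1 h2
    simp [h1, h2] at hab
  rw [hasTrajectory_ofPoly_iff, motionPoly, fst_mk, snd_mk]
  refine ⟨?_, ?_, 1, g * (a ^ 2 + b ^ 2), one_ne_zero, mul_ne_zero hg hN, ?_, ?_⟩
  · intro h
    have := mul_ne_zero (ne_zero_of_bezout hr) hz
    apply this
    apply quat_smul_cancel hg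
    rw [h, smul_zero]
  · simp [-mul_eq_zero] at hd0 hd3 ⊢
    linear_combination g * (a ^ 2 + b ^ 2) * hd0
  · rw [rotK_smul, rotK_mul_complex, one_smul, smul_smul, smul_smul]
    congr 1
    ring
  · simp at hd0 hd3 ⊢
    linear_combination -g * (a ^ 2 + b ^ 2) * hd3

end Motions

/-! ### Bounds for the degree of a motion -/

section MinimalDegree

theorem polyDegree_mul_halfTurn (w : DualQuat ℝ[X]) : polyDegree (w * halfTurn) = polyDegree w := by
  have key : ∀ q : ℍ[ℝ[X]], quatDegree (q * quat 0 1 0 0) = quatDegree q := by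
    intro q
    simp only [quatDegree, Quaternion.re_mul, Quaternion.imI_mul, Quaternion.imJ_mul,
      Quaternion.imK_mul, quat_re, quat_imI, quat_imJ, quat_imK, mul_zero, mul_one, zero_sub,
      sub_zero, add_zero, zero_add, Polynomial.natDegree_neg]
    rw [max_comm q.imI.natDegree, max_comm q.imK.natDegree]
  simp [polyDegree, halfTurn, key]

/-- The dual part of a motion of minimal degree. -/
theorem exists_dual_part {p m : ℍ[ℝ[X]]} (hr : (m * p).re = 1) (hk : (m * p).imK = 0)
    (u₀ : ℝ[X]) : ∃ d : ℍ[ℝ[X]], (star d * p).re = 0 ∧ 2 * (star d * p).imK = -u₀ ∧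
      quatDegree d ≤ max (quatDegree p) (u₀.natDegree - quatDegree p) := by
  obtain ⟨d, h0, h3, hd⟩ := exists_mul_imK_eq hr hk (Polynomial.C (-1 / 2) * u₀)
  refine ⟨star d, by rwa [star_star], ?_, ?_⟩
  · have h2 : (2 : ℝ[X]) * Polynomial.C (-1 / 2) = -1 := by
      have : (2 : ℝ[X]) = Polynomial.C 2 := rfl
      rw [this, ← map_mul]
      norm_num
    rw [star_star, h3, ← mul_assoc, h2, neg_one_mul]
  · rw [quatDegree_star]
    rwa [Polynomial.natDegree_C_mul (by norm_num)] at hd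

theorem complex_ne_zero {a b : ℝ[X]} (hab : a ≠ 0 ∨ b ≠ 0) : quat a 0 0 b ≠ 0 := fun h => by
  have h1 := congrArg (fun x => x.re) h
  have h2 := congrArg (fun x => x.imK) h
  simp at h1 h2
  simp [h1, h2] at hab

theorem natDegree_add_le_polyDegree_motionPoly {g : ℝ[X]} {p d : ℍ[ℝ[X]]} (hg : g ≠ 0) (hp : p ≠ 0)
    {a b : ℝ[X]} (hab : a ≠ 0 ∨ b ≠ 0) (l₁ l₂ : ℝ[X]) :
    g.natDegree + (quatDegree p + quatDegree (quat a 0 0 b)) ≤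
      polyDegree (motionPoly g p d a b l₁ l₂) := by
  have hz := complex_ne_zero hab
  rw [polyDegree, motionPoly, fst_mk, quatDegree_smul hg (mul_ne_zero hp hz), quatDegree_mul hp hz]
  exact le_max_left _ _

/-- The degree bound from the dual part `e`, in terms of the complex part `-u₀ (b + a k) / 2` of
`e* p`. -/
theorem natDegree_sub_le_polyDegree_motionPoly {g u₀ : ℝ[X]} {p d : ℍ[ℝ[X]]}
    (hd0 : (star d * p).re = 0)
    (hd3 : 2 * (star d * p).imK = -u₀) {a b : ℝ[X]} (hab : a ≠ 0 ∨ b ≠ 0) (l₁ l₂ : ℝ[X]) :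
    u₀.natDegree - quatDegree p ≤ polyDegree (motionPoly g p d a b l₁ l₂) := by
  set e := d * quat a 0 0 b + p * quat 0 l₁ l₂ 0 with he
  have h0 : 2 * (star e * p).re = -(u₀ * b) := by
    rw [he]
    simp [-mul_eq_zero] at hd0 hd3 ⊢
    linear_combination 2 * a * hd0 + b * hd3
  have h3 : 2 * (star e * p).imK = -(u₀ * a) := by
    rw [he]
    simp [-mul_eq_zero] at hd0 hd3 ⊢
    linear_combination -2 * b * hd0 + a * hd3
  have hle : u₀.natDegree ≤ quatDegree (star e * p) := by
    have key : ∀ f c : ℝ[X], c ≠ 0 → 2 * f = -(u₀ * c) → u₀.natDegree ≤ f.natDegree := by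
      intro f c hc h
      have h2 : (2 : ℝ[X]) = Polynomial.C 2 := rfl
      have h4 := congrArg Polynomial.natDegree h
      rw [h2, Polynomial.natDegree_C_mul two_ne_zero, Polynomial.natDegree_neg] at h4
      by_cases hu : u₀ = 0
      · simp [hu]
      · rw [Polynomial.natDegree_mul hu hc] at h4
        omega
    obtain ⟨g0, -, -, g3⟩ := quatDegree_le_iff.1 (le_refl (quatDegree (star e * p)))
    rcases hab with h | h
    · exact (key _ _ h h3).trans g3
    · exact (key _ _ h h0).trans g0
  have hmul := quatDegree_mul_le (star e) p
  rw [quatDegree_star] at hmul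
  rw [polyDegree, motionPoly, snd_mk, ← he]
  refine le_trans ?_ (le_max_right _ _)
  omega

theorem le_degree_of_hasTrajectory {g u₀ : ℝ[X]} {p m d : ℍ[ℝ[X]]}
    (hg : g ≠ 0) (hco : IsCoprime g u₀) (hr : (m * p).re = 1) (hk : (m * p).imK = 0)
    (hd0 : (star d * p).re = 0) (hd3 : 2 * (star d * p).imK = -u₀) {C : DualQuat RealRat}
    (hC : HasTrajectory C (ofPoly (torsePoly g u₀ p))) :
    max (g.natDegree + quatDegree p) (u₀.natDegree - quatDegree p) ≤ degree C := by
  obtain ⟨w, hw, hdeg⟩ := exists_polyDegree_eq_degree C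
  have hw' : HasTrajectory (ofPoly w) (ofPoly (torsePoly g u₀ p)) :=
    ⟨hw.isMotion hC.1, hw.symm.imageOfK.trans hC.2⟩
  obtain ⟨a, b, l₁, l₂, hab, h⟩ := exists_eq_motionPoly hg hco hr hk hd0 hd3 hw'
  have h1 := natDegree_add_le_polyDegree_motionPoly (d := d) hg (ne_zero_of_bezout hr) hab l₁ l₂
  have h2 := natDegree_sub_le_polyDegree_motionPoly (g := g) hd0 hd3 hab l₁ l₂
  have h3 : polyDegree w = polyDegree (motionPoly g p d a b l₁ l₂) := by
    rcases h with h | h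
    · rw [h]
    · rw [← h, polyDegree_mul_halfTurn]
  omega

theorem quat_one : (quat 1 0 0 0 : ℍ[ℝ[X]]) = 1 := rfl

theorem polyDegree_motionPoly_le {g : ℝ[X]} {p d : ℍ[ℝ[X]]} {n : ℕ}
    (h1 : g.natDegree + quatDegree p ≤ n) (h2 : quatDegree d ≤ n) {l : ℝ[X]}
    (h3 : l = 0 ∨ quatDegree p + l.natDegree ≤ n) : polyDegree (motionPoly g p d 1 0 l 0) ≤ n := by
  rw [polyDegree, motionPoly, fst_mk, snd_mk, quat_one, mul_one, mul_one]
  refine max_le ?_ (quatDegree_add_le h2 ?_)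
  · by_cases hg : g = 0
    · simp [hg, quatDegree]
    by_cases hp : p = 0
    · simp [hp, quatDegree]
    rwa [quatDegree_smul hg hp]
  · rcases h3 with rfl | h3
    · have : p * quat 0 0 0 0 = 0 := by ext1 <;> simp
      rw [this]
      simp [quatDegree]
    · refine (quatDegree_mul_le _ _).trans ?_
      have : quatDegree (quat 0 l 0 0) = l.natDegree := by simp [quatDegree]
      rwa [this]

end MinimalDegree

/-! ### Constant displacements -/

section Uniqueness

theorem ofConst_eq (e : DualQuat ℝ) : ofConst e = ofPoly (mapDual Polynomial.C e) := by
  have key : ∀ r : ℝ, RatFunc.C r = toRat (Polynomial.C r) := fun r =>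
    (RatFunc.algebraMap_C r).symm
  apply TrivSqZeroExt.ext <;> ext1 <;> simp [ofConst, mapDual, mapQuat, key]

theorem ofConst_mul (e f : DualQuat ℝ) : ofConst (e * f) = ofConst e * ofConst f := by
  apply TrivSqZeroExt.ext <;> ext1 <;> simp [ofConst, mapDual, mapQuat]

theorem SamePoint.ofConst {e f : DualQuat ℝ} (h : SamePoint e f) :
    SamePoint (ofConst e) (ofConst f) := by
  obtain ⟨c, hc, rfl⟩ := h
  refine ⟨algebraMap ℝ RealRat c, by simpa using hc, ?_⟩
  apply TrivSqZeroExt.ext <;> ext1 <;>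
    simp [PlaneMotion.ofConst, mapDual, mapQuat, -algebraMap_smul]

/-- Being equal up to a constant displacement that fixes `k` is left Euclidean. -/
theorem EssentiallyEqual.of_common {C C₁ C₂ : DualQuat RealRat} (h₁ : EssentiallyEqual C C₁)
    (h₂ : EssentiallyEqual C C₂) : EssentiallyEqual C₁ C₂ := by
  obtain ⟨e, he, hfe, hs⟩ := h₁
  obtain ⟨f, hf, hff, ht⟩ := h₂
  obtain ⟨r, hr, hfr, hsr⟩ := exists_mul_samePoint he hf (hff.trans hfe.symm)
  refine ⟨r, hr, hfr, ?_⟩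
  have h1 := hs.symm.mul (SamePoint.refl (ofConst r))
  rw [mul_assoc, ← ofConst_mul] at h1
  exact h1.trans (((SamePoint.refl C).mul hsr.ofConst).trans ht)

/-- If the coefficient `γ` of `p` and the polynomials `a, b, l₁, l₂` are constant, then the motion
given by `a, b, l₁, l₂` arises from a fixed one by a constant displacement. -/
theorem essentiallyEqual_motionPoly {γ : ℝ} (hγ : γ ≠ 0) (p d : ℍ[ℝ[X]]) {a b : ℝ}
    (hab : a ^ 2 + b ^ 2 ≠ 0) (l₁ l₂ : ℝ) {w : DualQuat ℝ[X]}
    (h : w = motionPoly (Polynomial.C γ) p d (Polynomial.C a) (Polynomial.C b) (Polynomial.C l₁)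
        (Polynomial.C l₂) ∨
      w * halfTurn = motionPoly (Polynomial.C γ) p d (Polynomial.C a) (Polynomial.C b)
        (Polynomial.C l₁) (Polynomial.C l₂)) :
    EssentiallyEqual (ofPoly (motionPoly (Polynomial.C γ) p d 1 0 0 0)) (ofPoly w) := by
  have hγ' : Polynomial.C γ⁻¹ * Polynomial.C γ = 1 := by
    rw [← map_mul, inv_mul_cancel₀ hγ, map_one]
  have h00 : (quat 0 0 0 0 : ℍ[ℝ[X]]) = 0 := rfl
  have hmain : motionPoly (Polynomial.C γ) p d 1 0 0 0 *
      mapDual Polynomial.C (mk (quat a 0 0 b) (quat 0 (γ⁻¹ * l₁) (γ⁻¹ * l₂) 0)) =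
      motionPoly (Polynomial.C γ) p d (Polynomial.C a) (Polynomial.C b) (Polynomial.C l₁)
        (Polynomial.C l₂) := by
    have e1 : mapQuat Polynomial.C (quat a 0 0 b) =
        quat (Polynomial.C a) 0 0 (Polynomial.C b) := by
      ext1 <;> simp [mapQuat]
    have e2 : mapQuat Polynomial.C (quat 0 (γ⁻¹ * l₁) (γ⁻¹ * l₂) 0) =
        Polynomial.C γ⁻¹ • quat 0 (Polynomial.C l₁) (Polynomial.C l₂) 0 := by
      ext1 <;> simp [mapQuat]
    apply TrivSqZeroExt.ext
    · simp only [motionPoly, quat_one, mul_one, TrivSqZeroExt.fst_mul, fst_mk, mapDual, e1,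
        quat_smul_mul]
    · simp only [motionPoly, quat_one, mul_one, h00, mul_zero, add_zero, TrivSqZeroExt.snd_mul,
        fst_mk, snd_mk, mapDual, e1, e2, smul_eq_mul, MulOpposite.smul_eq_mul_unop,
        MulOpposite.unop_op, quat_smul_mul, quat_mul_smul, smul_smul, hγ', one_smul]
      rw [add_comm]
  rcases h with h | h
  · obtain ⟨h1, h2⟩ := fixesK_rotation hab (γ⁻¹ * l₁) (γ⁻¹ * l₂)
    refine ⟨_, h1, h2, ?_⟩
    rw [ofConst_eq, ← ofPoly_mul, hmain, h]
    exact SamePoint.refl _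
  · obtain ⟨h1, h2⟩ := fixesK_halfTurn hab (-(γ⁻¹ * l₁)) (-(γ⁻¹ * l₂))
    refine ⟨_, h1, h2, ?_⟩
    have e3 : mapDual Polynomial.C (mk (quat 0 a b 0) (quat (-(γ⁻¹ * l₁)) 0 0 (-(γ⁻¹ * l₂)))) =
        mapDual Polynomial.C (mk (quat a 0 0 b) (quat 0 (γ⁻¹ * l₁) (γ⁻¹ * l₂) 0)) * halfTurn := by
      apply TrivSqZeroExt.ext <;> ext1 <;> simp [mapDual, mapQuat, halfTurn]
    have e4 : halfTurn * halfTurn = (-1 : ℝ[X]) • (1 : DualQuat ℝ[X]) := by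
      apply TrivSqZeroExt.ext <;> ext1 <;> simp [halfTurn]
    rw [ofConst_eq, ← ofPoly_mul, e3, ← mul_assoc, hmain, ← h, mul_assoc, e4, mul_smul_one]
    refine samePoint_ofPoly_of_smul (m := 1) (n := -1) one_ne_zero (neg_ne_zero.2 one_ne_zero) ?_
    rw [one_smul]

/-- If the motions with parameters `0` and `l` are essentially equal, then `l` and `g` are
proportional. -/
theorem exists_proportional {g : ℝ[X]} {p d : ℍ[ℝ[X]]} (hg : g ≠ 0) (hp : p ≠ 0) {l : ℝ[X]}
    (h : EssentiallyEqual (ofPoly (motionPoly g p d 1 0 0 0))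
      (ofPoly (motionPoly g p d 1 0 l 0))) :
    ∃ ρ σ : ℝ, ρ ≠ 0 ∧ l * Polynomial.C ρ = g * Polynomial.C σ := by
  obtain ⟨e, he, hfe, hs⟩ := h
  rw [ofConst_eq, ← ofPoly_mul, samePoint_ofPoly_iff] at hs
  obtain ⟨m, n, hm, hn, -, h⟩ := hs
  set f := mapDual Polynomial.C e with hf
  have h00 : (quat 0 0 0 0 : ℍ[ℝ[X]]) = 0 := rfl
  have h1 := congrArg TrivSqZeroExt.fst h
  have h2 := congrArg TrivSqZeroExt.snd h
  simp only [motionPoly, quat_one, mul_one, h00, mul_zero, add_zero, TrivSqZeroExt.fst_smul,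
    TrivSqZeroExt.snd_smul, TrivSqZeroExt.fst_mul, TrivSqZeroExt.snd_mul, fst_mk, snd_mk,
    smul_eq_mul, MulOpposite.smul_eq_mul_unop, MulOpposite.unop_op] at h1 h2
  have h3 : m • f.fst = n • (1 : ℍ[ℝ[X]]) := by
    apply mul_left_cancel₀ hp
    apply quat_smul_cancel hg
    rw [quat_mul_smul, quat_mul_smul, mul_one, smul_comm g n, ← h1, quat_smul_mul, smul_comm g m]
  have h4 : m • (g • f.snd) = n • quat 0 l 0 0 := by
    apply mul_left_cancel₀ hp
    have h5 : d * (m • f.fst) = d * (n • 1) := by rw [h3]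
    rw [quat_mul_smul, quat_mul_smul, mul_one] at h5
    rw [smul_add, smul_add, h5, quat_smul_mul] at h2
    have h6 : m • g • (p * f.snd) = n • (p * quat 0 l 0 0) := by
      rw [add_comm (n • d)] at h2
      exact add_right_cancel h2
    rw [quat_mul_smul, quat_mul_smul, quat_mul_smul, h6]
  have hre : f.fst.re = Polynomial.C e.fst.re := by simp [hf, mapDual, mapQuat]
  have him : f.snd.imI = Polynomial.C e.snd.imI := by simp [hf, mapDual, mapQuat]
  have h5 : m * Polynomial.C e.fst.re = n := by
    simpa [hre] using congrArg (fun x => x.re) h3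
  have h6 : m * (g * Polynomial.C e.snd.imI) = n * l := by
    simpa [him] using congrArg (fun x => x.imI) h4
  refine ⟨e.fst.re, e.snd.imI, ?_, ?_⟩
  · intro h0
    rw [h0, map_zero, mul_zero] at h5
    exact hn h5.symm
  · apply mul_left_cancel₀ hm
    rw [h6, ← h5]
    ring

end Uniqueness

/-! ### Motions of minimal degree -/

theorem hasTrajectory_congr {u v : DualQuat RealRat} (h : SamePoint u v) (C : DualQuat RealRat) :
    HasTrajectory C u ↔ HasTrajectory C v :=
  and_congr_right fun _ => ⟨fun hC => hC.trans h, fun hC => hC.trans h.symm⟩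

section

variable {g u₀ : ℝ[X]} {p m d : ℍ[ℝ[X]]}

theorem hasTrajectory_and_degree_eq (hg : g ≠ 0) (hco : IsCoprime g u₀) (hr : (m * p).re = 1)
    (hk : (m * p).imK = 0) (hd0 : (star d * p).re = 0) (hd3 : 2 * (star d * p).imK = -u₀)
    {l : ℝ[X]} (hl : polyDegree (motionPoly g p d 1 0 l 0) ≤
      max (g.natDegree + quatDegree p) (u₀.natDegree - quatDegree p)) :
    HasTrajectory (ofPoly (motionPoly g p d 1 0 l 0)) (ofPoly (torsePoly g u₀ p)) ∧
      degree (ofPoly (motionPoly g p d 1 0 l 0)) =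
        max (g.natDegree + quatDegree p) (u₀.natDegree - quatDegree p) := by
  have h := hasTrajectory_motionPoly hg hr hd0 hd3 (Or.inl (one_ne_zero (α := ℝ[X])))
    (b := 0) l 0
  exact ⟨h, le_antisymm ((degree_le (SamePoint.refl _)).trans hl)
    (le_degree_of_hasTrajectory hg hco hr hk hd0 hd3 h)⟩

theorem isMinimalMotion_motionPoly (hg : g ≠ 0) (hco : IsCoprime g u₀) (hr : (m * p).re = 1)
    (hk : (m * p).imK = 0) (hd0 : (star d * p).re = 0) (hd3 : 2 * (star d * p).imK = -u₀)
    {l : ℝ[X]} (hl : polyDegree (motionPoly g p d 1 0 l 0) ≤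
      max (g.natDegree + quatDegree p) (u₀.natDegree - quatDegree p)) :
    IsMinimalMotion (ofPoly (motionPoly g p d 1 0 l 0)) (ofPoly (torsePoly g u₀ p)) := by
  obtain ⟨h1, h2⟩ := hasTrajectory_and_degree_eq hg hco hr hk hd0 hd3 hl
  refine ⟨h1, fun C hC => ?_⟩
  rw [h2]
  exact le_degree_of_hasTrajectory hg hco hr hk hd0 hd3 hC

/-- If `g` is constant and the minimal degree is that of `p`, then every minimal motion has
constant parameters in the family `motionPoly`. -/
theorem essentiallyEqual_of_degree_eq (hg : g ≠ 0) (hco : IsCoprime g u₀) (hr : (m * p).re = 1)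
    (hk : (m * p).imK = 0) (hd0 : (star d * p).re = 0) (hd3 : 2 * (star d * p).imK = -u₀)
    (hd : quatDegree d ≤ quatDegree p) (hg0 : g.natDegree = 0) {C : DualQuat RealRat}
    (hC : HasTrajectory C (ofPoly (torsePoly g u₀ p))) (hdeg : degree C ≤ quatDegree p) :
    EssentiallyEqual (ofPoly (motionPoly g p d 1 0 0 0)) C := by
  have hp := ne_zero_of_bezout hr
  obtain ⟨w, hw, hwdeg⟩ := exists_polyDegree_eq_degree C
  have hw' : HasTrajectory (ofPoly w) (ofPoly (torsePoly g u₀ p)) :=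
    ⟨hw.isMotion hC.1, hw.symm.imageOfK.trans hC.2⟩
  obtain ⟨a, b, l₁, l₂, hab, h⟩ := exists_eq_motionPoly hg hco hr hk hd0 hd3 hw'
  have h3 : polyDegree (motionPoly g p d a b l₁ l₂) ≤ quatDegree p := by
    rcases h with h | h
    · rw [← h, hwdeg]
      exact hdeg
    · rw [← h, polyDegree_mul_halfTurn, hwdeg]
      exact hdeg
  have h1 := natDegree_add_le_polyDegree_motionPoly (d := d) hg hp hab l₁ l₂
  have hα : quatDegree (quat a 0 0 b) = 0 := by omega
  have hl : quatDegree (quat 0 l₁ l₂ 0) = 0 := by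
    by_cases hl0 : quat 0 l₁ l₂ 0 = 0
    · rw [hl0]
      simp [quatDegree]
    have h4 : quatDegree (d * quat a 0 0 b + p * quat 0 l₁ l₂ 0) ≤ quatDegree p := by
      rw [polyDegree, motionPoly, snd_mk] at h3
      exact (le_max_right _ _).trans h3
    have h5 : quatDegree (-(d * quat a 0 0 b)) ≤ quatDegree p := by
      rw [quatDegree_neg]
      exact (quatDegree_mul_le _ _).trans (by omega)
    have h6 := quatDegree_add_le h4 h5
    rw [add_comm (d * quat a 0 0 b), add_assoc, add_neg_cancel, add_zero,
      quatDegree_mul hp hl0] at h6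
    omega
  obtain ⟨γ, rfl⟩ := Polynomial.natDegree_eq_zero.1 hg0
  obtain ⟨ha, -, -, hb⟩ := quatDegree_le_iff.1 hα.le
  obtain ⟨-, hl1, hl2, -⟩ := quatDegree_le_iff.1 hl.le
  obtain ⟨a, rfl⟩ := Polynomial.natDegree_eq_zero.1 (Nat.le_zero.1 ha)
  obtain ⟨b, rfl⟩ := Polynomial.natDegree_eq_zero.1 (Nat.le_zero.1 hb)
  obtain ⟨l₁, rfl⟩ := Polynomial.natDegree_eq_zero.1 (Nat.le_zero.1 hl1)
  obtain ⟨l₂, rfl⟩ := Polynomial.natDegree_eq_zero.1 (Nat.le_zero.1 hl2)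
  have hab' : a ^ 2 + b ^ 2 ≠ 0 := by
    rw [Ne, Polynomial.C_eq_zero, Ne, Polynomial.C_eq_zero] at hab
    rcases hab with h | h <;> positivity
  obtain ⟨e, he, hfe, hs⟩ := essentiallyEqual_motionPoly (fun h0 => hg (by rw [h0, map_zero]))
    p d hab' l₁ l₂ h
  exact ⟨e, he, hfe, hs.trans hw.symm⟩

theorem forall_essentiallyEqual_iff (hg : g ≠ 0) (hco : IsCoprime g u₀) (hr : (m * p).re = 1)
    (hk : (m * p).imK = 0) (hd0 : (star d * p).re = 0) (hd3 : 2 * (star d * p).imK = -u₀)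
    (hd : quatDegree d ≤ max (quatDegree p) (u₀.natDegree - quatDegree p)) :
    (∀ C C' : DualQuat RealRat, IsMinimalMotion C (ofPoly (torsePoly g u₀ p)) →
      IsMinimalMotion C' (ofPoly (torsePoly g u₀ p)) → EssentiallyEqual C C') ↔
      max (g.natDegree + 2 * quatDegree p) u₀.natDegree = 2 * quatDegree p := by
  constructor
  · intro h
    by_contra hne
    -- the minimal degree exceeds `deg p`, which leaves room for linear `l₁`
    have hmin : ∀ l : ℝ[X], l.natDegree ≤ 1 →
        IsMinimalMotion (ofPoly (motionPoly g p d 1 0 l 0)) (ofPoly (torsePoly g u₀ p)) := by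
      intro l hl
      apply isMinimalMotion_motionPoly hg hco hr hk hd0 hd3
      apply polyDegree_motionPoly_le (le_max_left _ _)
      · omega
      · right
        omega
    have hp := ne_zero_of_bezout hr
    have h0 := hmin 0 (by simp)
    obtain ⟨ρ, σ, hρ, e1⟩ := exists_proportional hg hp (h _ _ h0 (hmin 1 (by simp)))
    obtain ⟨ρ', σ', hρ', e2⟩ := exists_proportional hg hp
      (h _ _ h0 (hmin Polynomial.X Polynomial.natDegree_X_le))
    -- `g` divides a non-zero constant, and `t` is a constant multiple of `g`
    have hg0 : g.natDegree = 0 := by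
      apply Polynomial.natDegree_eq_zero_of_isUnit
      refine isUnit_of_dvd_unit ⟨_, e1⟩ ?_
      rw [one_mul, Polynomial.isUnit_C]
      exact isUnit_iff_ne_zero.2 hρ
    have h1 := congrArg Polynomial.natDegree e2
    rw [Polynomial.natDegree_mul_C hρ', Polynomial.natDegree_X] at h1
    have h2 := Polynomial.natDegree_mul_C_le g σ'
    omega
  · intro h C C' hC hC'
    have hg0 : g.natDegree = 0 := by omega
    have hd' : quatDegree d ≤ quatDegree p := by omega
    obtain ⟨h1, h2⟩ := hasTrajectory_and_degree_eq hg hco hr hk hd0 hd3 (l := 0)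
      (polyDegree_motionPoly_le (le_max_left _ _) (by omega) (Or.inl rfl))
    have key : ∀ C : DualQuat RealRat, IsMinimalMotion C (ofPoly (torsePoly g u₀ p)) →
        EssentiallyEqual (ofPoly (motionPoly g p d 1 0 0 0)) C := by
      intro C hC
      apply essentiallyEqual_of_degree_eq hg hco hr hk hd0 hd3 hd' hg0 hC.1
      have := hC.2 _ h1
      omega
    exact (key C hC).of_common (key C' hC')

end

end PlaneMotion

theorem theorem1 (u : DualQuat RealRat) (hu : IsTorse u) (hvec : u.fst ≠ 0) :
    (IsKinematic u ↔ ∃ n : ℍ[RealRat], IsGaussMap u n) ∧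
    (IsKinematic u → ∀ n : ℍ[RealRat], IsGaussMap u n →
      -- existence
      (∃ C : DualQuat RealRat, HasTrajectory C u ∧
        (degree C : ℚ) = (degree u : ℚ) - (degree (curveOf n) : ℚ) / 2) ∧
      -- minimality
      (∀ C : DualQuat RealRat, HasTrajectory C u →
        (degree u : ℚ) - (degree (curveOf n) : ℚ) / 2 ≤ (degree C : ℚ)) ∧
      -- essential uniqueness
      ((∀ C C' : DualQuat RealRat, IsMinimalMotion C u → IsMinimalMotion C' u →
          EssentiallyEqual C C') ↔ degree u = degree (curveOf n)) ∧
      -- all motions with the given trajectory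
      (∀ C : DualQuat RealRat, IsMinimalMotion C u → ∀ C' : DualQuat RealRat,
        HasTrajectory C' u ↔
          ∃ E : DualQuat RealRat, IsMotion E ∧ FixesK E ∧ SamePoint (C * E) C')) ∧
    -- shape of the rational motions that fix the plane
    (∀ E : DualQuat RealRat, (IsMotion E ∧ FixesK E) ↔
      ∃ a b c d : ℝ[X], (a ≠ 0 ∨ b ≠ 0) ∧
        (SamePoint E (ofPoly (mk (quat a 0 0 b) (quat 0 c d 0))) ∨
         SamePoint E (ofPoly (mk (quat 0 a b 0) (quat c 0 0 d))))) := by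
  refine ⟨isKinematic_iff hu hvec, fun _ n hn => ?_, fixesK_shape⟩
  obtain ⟨g, u₀, p, m, hg, hco, hr, hk, hs⟩ := exists_normalForm hu hn
  obtain ⟨d, hd0, hd3, hd⟩ := exists_dual_part hr hk u₀
  have hdu := degree_torse hg hco hr hk hs
  have hdn := degree_gaussMap hg hr hk hs hn
  have hdiff : (degree u : ℚ) - (degree (curveOf n) : ℚ) / 2 =
      (max (g.natDegree + quatDegree p) (u₀.natDegree - quatDegree p) : ℕ) := by
    have h1 : degree u = max (g.natDegree + quatDegree p) (u₀.natDegree - quatDegree p) +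
        quatDegree p := by omega
    rw [hdn, h1]
    push_cast
    ring
  rw [hdiff]
  have htraj : ∀ C, HasTrajectory C u ↔ HasTrajectory C (ofPoly (torsePoly g u₀ p)) :=
    hasTrajectory_congr hs
  refine ⟨?_, fun C hC => ?_, ?_, fun C hC C' => hasTrajectory_iff_exists_mul hC.1 C'⟩
  · obtain ⟨h1, h2⟩ := hasTrajectory_and_degree_eq hg hco hr hk hd0 hd3 (l := 0)
      (polyDegree_motionPoly_le (le_max_left _ _) (by omega) (Or.inl rfl))
    exact ⟨_, (htraj _).2 h1, by rw [h2]⟩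
  · exact_mod_cast le_degree_of_hasTrajectory hg hco hr hk hd0 hd3 ((htraj C).1 hC)
  · rw [hdu, hdn, ← forall_essentiallyEqual_iff hg hco hr hk hd0 hd3 hd]
    simp only [IsMinimalMotion, htraj]
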